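/- Work in the first-order language of arithmetic with constants $0,1$, binary operations $+,\times$ and a binary relation $\le$; write $x<y$ for $x\le y\wedge x\ne y$, $x\mid y$ for $\exists z\,(z\cdot x=y)$, $2:=1+1$, $3:=2+1$, and let $$\mathsf{pow}_2(x):\Leftrightarrow\forall y\,(y\mid x\to(y=1\vee 2\mid y))\quad\text{(Smullyan)},\qquad \mathsf{pow}_2^{\mathsf{tar}}(x):\Leftrightarrow\forall y\,\forall z\;x\ne(2y+3)\cdot z\quad\text{(Tarski)}.$$ Let $\mathsf{PA}^-$ be the theory of the non-negative parts of discretely ordered commutative rings, axiomatised by (the universal closures of): $x+0=x$; $x+y=y+x$; $(x+y)+z=x+(y+z)$; $x\cdot1=x$; $xy=yx$; $(xy)z=x(yz)$; $x(y+z)=xy+xz$; $x\le y\vee y\le x$; $(x\le y\wedge y\le z)\to x\le z$; $x+1\not\le x$; $y\le x\to(y=x\vee y+1\le x)$; $y\le x\to y+z\le x+z$; $y\le x\to yz\le xz$; $y\le x\to\exists z\,(x=y+z)$. Let $\mathsf{IOpen}$ be $\mathsf{PA}^-$ together with the induction axioms $(\varphi(0)\wedge\forall x(\varphi(x)\to\varphi(x+1)))\to\forall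 x\,\varphi(x)$ for all quantifier-free formulas $\varphi$, with parameters allowed. Let $\mathsf{PA}^-_{\mathsf{smu}}$ be $\mathsf{PA}^-$ together with the Powers Existence Principle $$\forall x\,\exists y\,(\mathsf{pow}_2(y)\wedge y\le x+1\wedge x+1<2y)$$ and the Powers Division Principle $\forall x\,\forall y\,((\mathsf{pow}_2(x)\wedge\mathsf{pow}_2(y)\wedge x\le y)\to x\mid y)$. Let $\mathbb S$ (Shepherdson's model) consist of all formal expressions $P=a_nX^{n/q}+a_{n-1}X^{(n-1)/q}+\dots+a_1X^{1/q}+a_0$, where $q>0$ is an integer, the $a_i$ are real algebraic numbers, $a_0\in\mathbb Z$, and $P$ is zero or has positive leading coefficient, with the usual addition and multiplication, ordered by: $P\le Q$ iff $Q-P$ is zero or has positive leading coefficient. Call an element of $\mathbb S$ nonstandard if it is not a natural number. Then: 1. $\mathbb S$ is a model of $\mathsf{IOpen}$. 2. In $\mathbb S$ the formulas $\mathsf{pow}_2$ and $\mathsf{pow}_2^{\mathsf{tar}}$ define the same set, and no nonstandard element of $\mathbb S$ satisfies either of them. 3. $\mathsf{IOpen}$ does not prove the Powers Existence Principle. 4.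 $\mathsf{PA}^-_{\mathsf{smu}}$ is not contained in $\mathsf{IOpen}$: some theorem of $\mathsf{PA}^-_{\mathsf{smu}}$ is not a theorem of $\mathsf{IOpen}$. -/

import Mathlib

open FirstOrder FirstOrder.Language

/-! ### The language of arithmetic: `0`, `1`, `+`, `×`, `≤` -/

/-- Function symbols of the language of arithmetic. -/
inductive ArithFunc : ℕ → Type
  | zero : ArithFunc 0
  | one : ArithFunc 0
  | add : ArithFunc 2
  | mul : ArithFunc 2

/-- Relation symbols of the language of arithmetic. -/
inductive ArithRel : ℕ → Type
  | le : ArithRel 2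

/-- The first-order language with constants `0`, `1`, binary operations `+`, `×` and a binary
relation `≤`. -/
def arith : FirstOrder.Language.{0, 0} where
  Functions := ArithFunc
  Relations := ArithRel

namespace Arith

instance {α : Type} : Zero (arith.Term α) :=
  ⟨Constants.term (L := arith) ArithFunc.zero⟩

instance {α : Type} : One (arith.Term α) :=
  ⟨Constants.term (L := arith) ArithFunc.one⟩

instance {α : Type} : Add (arith.Term α) :=
  ⟨Functions.apply₂ (L := arith) ArithFunc.add⟩

instance {α : Type} : Mul (arith.Term α) :=
  ⟨Functions.apply₂ (L := arith) ArithFunc.mul⟩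

/-- Formulas of arithmetic without free variables other than the de Bruijn levels
`&0, …, &(n-1)`. -/
abbrev Fml (n : ℕ) := arith.BoundedFormula Empty n

/-- Terms in the variables `&0, …, &(n-1)`. -/
abbrev Tm (n : ℕ) := arith.Term (Empty ⊕ Fin n)

/-- A term in `n` variables regarded as a term in `n + 1` variables. -/
def up {n : ℕ} (t : Tm n) : Tm (n + 1) := t.relabel (Sum.map id Fin.castSucc)

/-- The newest variable, i.e. the one bound by the innermost quantifier. -/
def new {n : ℕ} : Tm (n + 1) := Term.var (Sum.inr (Fin.last n))

/-- The numeral `2 = 1 + 1`. -/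
def two {n : ℕ} : Tm n := 1 + 1

/-- The numeral `3 = 2 + 1`. -/
def three {n : ℕ} : Tm n := two + 1

/-- `s ≤ t` -/
def le {n : ℕ} (s t : Tm n) : Fml n := Relations.boundedFormula₂ (L := arith) ArithRel.le s t

/-- `s < t`, i.e. `s ≤ t ∧ s ≠ t` -/
def lt {n : ℕ} (s t : Tm n) : Fml n := le s t ⊓ ∼(s =' t)

/-- `s ∣ t`, i.e. `∃ z, z · s = t` -/
def dvd {n : ℕ} (s t : Tm n) : Fml n := ∃' ((new * up s) =' up t)

/-- Smullyan's powers of two: `∀ y, y ∣ t → y = 1 ∨ 2 ∣ y` -/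
def pow2 {n : ℕ} (t : Tm n) : Fml n := ∀' (dvd new (up t) ⟹ ((new =' 1) ⊔ dvd two new))

/-- Tarski's powers of two: `∀ y z, t ≠ (2 · y + 3) · z` -/
def pow2Tar {n : ℕ} (t : Tm n) : Fml n :=
  ∀' ∀' ∼(up (up t) =' ((two * up new + three) * new))

/-! ### The theories -/

/-- The axioms of the theory of discretely ordered commutative semirings with least element. -/
def PAjer : arith.Theory :=
  { ∀' (((&0 : Tm 1) + 0) =' &0),
    ∀' ∀' (((&0 : Tm 2) + &1) =' (&1 + &0)),
    ∀' ∀' ∀' ((((&0 : Tm 3) + &1) + &2) =' (&0 + (&1 + &2))),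
    ∀' (((&0 : Tm 1) * 1) =' &0),
    ∀' ∀' (((&0 : Tm 2) * &1) =' (&1 * &0)),
    ∀' ∀' ∀' ((((&0 : Tm 3) * &1) * &2) =' (&0 * (&1 * &2))),
    ∀' ∀' ∀' (((&0 : Tm 3) * (&1 + &2)) =' (&0 * &1 + &0 * &2)),
    ∀' ∀' (le (&0 : Tm 2) &1 ⊔ le &1 &0),
    ∀' ∀' ∀' ((le (&0 : Tm 3) &1 ⊓ le &1 &2) ⟹ le &0 &2),
    ∀' ∼(le ((&0 : Tm 1) + 1) &0),
    ∀' ∀' (le (&1 : Tm 2) &0 ⟹ ((&1 =' &0) ⊔ le (&1 + 1) &0)),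
    ∀' ∀' ∀' (le (&1 : Tm 3) &0 ⟹ le (&1 + &2) (&0 + &2)),
    ∀' ∀' ∀' (le (&1 : Tm 3) &0 ⟹ le (&1 * &2) (&0 * &2)) }

/-- The Subtraction Principle: `∀ x y, y ≤ x → ∃ z, x = y + z` -/
def subtraction : arith.Sentence :=
  ∀' ∀' (le (&1 : Tm 2) &0 ⟹ ∃' ((&0 : Tm 3) =' (&1 + &2)))

/-- `PA⁻`, the theory of the non-negative parts of discretely ordered commutative rings. -/
def PAminus : arith.Theory := PAjer ∪ {subtraction}

/-- The Powers Existence Principle: `∀ x, ∃ y, pow₂(y) ∧ y ≤ x + 1 ∧ x + 1 < 2 · y` -/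
def powersExistence : arith.Sentence :=
  ∀' ∃' (pow2 (&1 : Tm 2) ⊓ (le &1 (&0 + 1) ⊓ lt (&0 + 1) (two * &1)))

/-- The Powers Division Principle: `∀ x y, pow₂(x) ∧ pow₂(y) ∧ x ≤ y → x ∣ y` -/
def powersDivision : arith.Sentence :=
  ∀' ∀' ((pow2 (&0 : Tm 2) ⊓ (pow2 &1 ⊓ le &0 &1)) ⟹ dvd &0 &1)

/-- `PA⁻_smu`: `PA⁻` plus the Powers Existence and the Powers Division Principles. -/
def PAsmu : arith.Theory := PAminus ∪ {powersExistence, powersDivision}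

/-- The induction axiom for the formula `φ`, whose free variables are the parameters
`Sum.inl 0, …, Sum.inl (k-1)` and the induction variable `Sum.inr ()`: the universal closure of
`φ(0) ∧ (∀ x, φ(x) → φ(x + 1)) → ∀ x, φ(x)`. -/
noncomputable def induction {k : ℕ} (φ : arith.Formula (Fin k ⊕ Unit)) : arith.Sentence :=
  let φ0 : arith.Formula (Fin k) := φ.subst (Sum.elim Term.var (fun _ => 0))
  let φsucc : arith.Formula (Fin k ⊕ Unit) :=
    φ.subst (Sum.elim (fun i => Term.var (Sum.inl i)) (fun _ => Term.var (Sum.inr ()) + 1))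
  let ind : arith.Formula (Fin k) :=
    (φ0 ⊓ Formula.iAlls Unit (φ ⟹ φsucc)) ⟹ Formula.iAlls Unit φ
  Formula.iAlls (Fin k) (Formula.relabel (Sum.inr : Fin k → Empty ⊕ Fin k) ind)

/-- `IOpen`: `PA⁻` plus induction for all open (quantifier-free) formulas, with parameters. -/
def IOpen : arith.Theory :=
  PAminus ∪ {σ | ∃ (k : ℕ) (φ : arith.Formula (Fin k ⊕ Unit)), φ.IsQF ∧ σ = induction φ}

/-- `T` is a subtheory of `T'`: every theorem of `T` is a theorem of `T'`. -/
def IsSubtheory (T T' : arith.Theory) : Prop := ∀ σ : arith.Sentence, T ⊨ᵇ σ → T' ⊨ᵇ σ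

/-- `a` satisfies Smullyan's definition of a power of two in `M`. -/
def IsPow2 {M : Type} [arith.Structure M] (a : M) : Prop :=
  (pow2 (&0 : Tm 1)).Realize default ![a]

/-- `a` satisfies Tarski's definition of a power of two in `M`. -/
def IsPow2Tar {M : Type} [arith.Structure M] (a : M) : Prop :=
  (pow2Tar (&0 : Tm 1)).Realize default ![a]

/-! ### Shepherdson's model -/

/-- The field of real algebraic numbers. -/
abbrev RealAlg : Type := algebraicClosure ℚ ℝ

/-- Formal finite sums `∑ aᵣ X ^ r` with exponents `r` in the non-negative rationals and real
algebraic coefficients, i.e. polynomials over the real algebraic numbers in some `X ^ (1 / q)`,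
`q > 0`. -/
abbrev FracPoly : Type := AddMonoidAlgebra RealAlg ℚ≥0

/-- `P` is zero or its leading coefficient is positive. -/
def Nonneg (P : FracPoly) : Prop :=
  P = 0 ∨ ∃ r : ℚ≥0, 0 < (P.coeff r : ℝ) ∧ ∀ s, r < s → P.coeff s = 0

theorem Nonneg.add {P Q : FracPoly} (hP : Nonneg P) (hQ : Nonneg Q) : Nonneg (P + Q) := by
  rcases hP with rfl | ⟨r, hr, hr'⟩
  · simpa using hQ
  rcases hQ with rfl | ⟨s, hs, hs'⟩
  · exact Or.inr ⟨r, by simpa using hr, by simpa using hr'⟩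
  right
  rcases lt_trichotomy r s with h | rfl | h
  · refine ⟨s, ?_, fun t ht => ?_⟩
    · simpa [hr' s h] using hs
    · simp [hr' t (h.trans ht), hs' t ht]
  · refine ⟨r, ?_, fun t ht => ?_⟩
    · simpa using add_pos hr hs
    · simp [hr' t ht, hs' t ht]
  · refine ⟨r, ?_, fun t ht => ?_⟩
    · simpa [hs' r h] using hr
    · simp [hr' t ht, hs' t (h.trans ht)]

theorem Nonneg.mul {P Q : FracPoly} (hP : Nonneg P) (hQ : Nonneg Q) : Nonneg (P * Q) := by
  classical
  rcases hP with rfl | ⟨r, hr, hr'⟩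
  · exact Or.inl (zero_mul _)
  rcases hQ with rfl | ⟨s, hs, hs'⟩
  · exact Or.inl (mul_zero _)
  right
  have key : ∀ a b : ℚ≥0, r + s ≤ a + b → (a = r ∧ b = s) ∨ P.coeff a * Q.coeff b = 0 := by
    intro a b hab
    rcases lt_or_ge r a with h | h
    · exact Or.inr (by rw [hr' a h, zero_mul])
    rcases lt_or_ge s b with h' | h'
    · exact Or.inr (by rw [hs' b h', mul_zero])
    left
    constructor
    · refine le_antisymm h ?_
      by_contra hc
      exact absurd hab (not_le.2 (add_lt_add_of_lt_of_le (not_le.1 hc) h'))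
    · refine le_antisymm h' ?_
      by_contra hc
      exact absurd hab (not_le.2 (add_lt_add_of_le_of_lt h (not_le.1 hc)))
  have hne : P.coeff r ≠ 0 := fun h => by simp [h] at hr
  have hne' : Q.coeff s ≠ 0 := fun h => by simp [h] at hs
  refine ⟨r + s, ?_, fun t ht => ?_⟩
  · have : (P * Q).coeff (r + s) = P.coeff r * Q.coeff s := by
      rw [AddMonoidAlgebra.coeff_mul, Finsupp.sum, Finset.sum_eq_single r]
      · rw [Finsupp.sum, Finset.sum_eq_single s]
        · simp
        · intro b _ hb
          rw [if_neg]
          exact fun h => hb (add_left_cancel h)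
        · intro h
          simp [Finsupp.notMem_support_iff.1 h]
      · intro a _ ha
        refine Finset.sum_eq_zero fun b _ => ?_
        dsimp only
        split_ifs with h
        · rcases key a b h.ge with h1 | h1
          · exact absurd h1.1 ha
          · exact h1
        · rfl
      · intro h
        exact absurd (Finsupp.notMem_support_iff.1 h) hne
    rw [this]
    simpa using mul_pos hr hs
  · rw [AddMonoidAlgebra.coeff_mul]
    refine Finset.sum_eq_zero fun a _ => Finset.sum_eq_zero fun b _ => ?_
    dsimp only
    split_ifs with h
    · rcases key a b (h ▸ ht.le) with h1 | h1
      · rw [← h, h1.1, h1.2] at ht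
        exact absurd ht (lt_irrefl _)
      · exact h1
    · rfl

theorem coeff_zero_mul (P Q : FracPoly) : (P * Q).coeff 0 = P.coeff 0 * Q.coeff 0 := by
  classical
  rw [AddMonoidAlgebra.coeff_mul, Finsupp.sum, Finset.sum_eq_single 0]
  · rw [Finsupp.sum, Finset.sum_eq_single 0]
    · simp
    · intro b _ hb
      simp [hb]
    · intro h
      simp [Finsupp.notMem_support_iff.1 h]
  · intro a _ ha
    refine Finset.sum_eq_zero fun b _ => ?_
    dsimp only
    rw [if_neg]
    exact fun h => ha (add_eq_zero.1 h).1
  · intro h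
    simp [Finsupp.notMem_support_iff.1 h]

/-- The elements of Shepherdson's model: the sums `∑ aᵣ X ^ r` which are zero or have positive
leading coefficient and whose constant coefficient is an integer. -/
noncomputable def shepherdson : Subsemiring FracPoly where
  carrier := {P | Nonneg P ∧ ∃ k : ℤ, P.coeff 0 = (k : RealAlg)}
  zero_mem' := ⟨Or.inl rfl, 0, by simp⟩
  one_mem' := by
    refine ⟨Or.inr ⟨0, ?_, fun s hs => ?_⟩, 1, ?_⟩
    · simp [AddMonoidAlgebra.one_def]
    · simp [AddMonoidAlgebra.one_def, hs.ne']
    · simp [AddMonoidAlgebra.one_def]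
  add_mem' := by
    rintro P Q ⟨hP, k, hk⟩ ⟨hQ, l, hl⟩
    exact ⟨hP.add hQ, k + l, by simp [hk, hl]⟩
  mul_mem' := by
    rintro P Q ⟨hP, k, hk⟩ ⟨hQ, l, hl⟩
    exact ⟨hP.mul hQ, k * l, by rw [coeff_zero_mul, hk, hl]; push_cast; rfl⟩

/-- The domain of Shepherdson's model. -/
abbrev Shepherdson : Type := shepherdson

/-- Shepherdson's model: the operations are those of formal sums, and `P ≤ Q` means that `Q - P`
is zero or has positive leading coefficient. -/
noncomputable instance : arith.Structure Shepherdson where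
  funMap
    | ArithFunc.zero, _ => 0
    | ArithFunc.one, _ => 1
    | ArithFunc.add, v => v 0 + v 1
    | ArithFunc.mul, v => v 0 * v 1
  RelMap
    | ArithRel.le, v => Nonneg ((v 1 : FracPoly) - (v 0 : FracPoly))

end Arith

/-!
The sign of a polynomial `p` over the ring of formal sums is decided by comparison with finitely
many cut points. For an argument `x` with leading term `c X ^ r`, the sign of `p x` is that of the
initial form of `p` at `c`, where `r` is the weight of the variable, unless `c` is a root. Around a
root one recentres at an approximate root, as in the theorem of Newton and Puiseux: by compactness
only finitely many `c` matter for each slope `r` of the Newton polygon, and for a suitable centre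
the multiplicities of the roots drop from one slope to the next. A root of multiplicity `k + 1` of
the initial form is a simple root of its `k`-th derivative, so Newton's method for the `k`-th
derivative of `p` supplies that centre.

Every nonnegative formal sum has an integer part in Shepherdson's model, so a subset of the model
defined by an open formula is decided by finitely many cut points in the model itself. If it
contains `0` and is closed under successors, it is everything: the element before the least cut
point outside it is not separated by any cut point from an element of the set.

A natural number `n ≠ 0` divides an element of the model as soon as it divides the constant
coefficient. So every nonstandard element has an odd divisor other than `1`, and no power of two
`y` satisfies `y ≤ X + 1 < 2 y`.
-/

open Polynomial Filter Topology
open SignType (sign)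
open AddMonoidAlgebra (single)

namespace Arith

/-! ### Coefficients, degree and order of formal sums -/

/-- The largest exponent of a formal sum, with the value `0` at the zero sum. -/
noncomputable abbrev deg (f : FracPoly) : ℚ≥0 := f.supDegree id

/-- The coefficient of a formal sum at a rational exponent, which is `0` at negative exponents:
allowing these makes the weights of the Newton polygon argument an ordered group. -/
noncomputable def coeffAt (s : ℚ) : FracPoly →+ RealAlg where
  toFun f := if 0 ≤ s then f.coeff s.toNNRat else 0
  map_zero' := by simp
  map_add' f g := by split_ifs <;> simp

/-- The formal sums all of whose exponents are at most `s`. -/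
def degLE (s : ℚ) : AddSubgroup FracPoly where
  carrier := {f | ∀ t, s < t → coeffAt t f = 0}
  zero_mem' _ _ := map_zero _
  add_mem' hf hg t ht := by rw [map_add, hf t ht, hg t ht, add_zero]
  neg_mem' hf t ht := by rw [map_neg, hf t ht, neg_zero]

section Coefficients

variable {f g : FracPoly} {s t : ℚ}

theorem coeffAt_coe (s : ℚ≥0) (f : FracPoly) : coeffAt s f = f.coeff s := by
  simp [coeffAt]

theorem coeffAt_of_neg (hs : s < 0) (f : FracPoly) : coeffAt s f = 0 :=
  if_neg hs.not_ge

theorem coeffAt_eq_zero (hf : f ∈ degLE s) (hst : s < t) : coeffAt t f = 0 := hf t hst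

theorem degLE_mono (hst : s ≤ t) : degLE s ≤ degLE t :=
  fun _ hf a ha => hf a (hst.trans_lt ha)

theorem mem_degLE_coe {s : ℚ≥0} : f ∈ degLE s ↔ deg f ≤ s := by
  refine ⟨fun hf => Finset.sup_le fun t ht => ?_, fun hf t ht => ?_⟩
  · by_contra! hst
    rw [Finsupp.mem_support_iff, ← coeffAt_coe] at ht
    exact ht (hf t (NNRat.cast_lt.2 hst))
  · lift t to ℚ≥0 using s.cast_nonneg.trans ht.le
    rw [coeffAt_coe]
    exact AddMonoidAlgebra.coeff_eq_zero_of_not_le_supDegree (D := id)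
      (not_le.2 (hf.trans_lt (NNRat.cast_lt.1 ht)))

theorem mem_degLE_deg (f : FracPoly) : f ∈ degLE (deg f) := mem_degLE_coe.2 le_rfl

theorem coeffAt_deg_ne_zero (hf : f ≠ 0) : coeffAt (deg f) f ≠ 0 := by
  obtain ⟨a, ha, hdeg⟩ := AddMonoidAlgebra.exists_supDegree_mem_support id hf
  rw [coeffAt_coe, deg, hdeg]
  exact Finsupp.mem_support_iff.1 ha

theorem eq_zero_of_mem_degLE_of_neg (hf : f ∈ degLE s) (hs : s < 0) : f = 0 := by
  by_contra hne
  exact coeffAt_deg_ne_zero hne (hf _ (hs.trans_le (NNRat.cast_nonneg _)))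

theorem deg_lt_of_coeffAt_eq_zero (hf : f ∈ degLE s) (hc : coeffAt s f = 0) (hs : 0 < s) :
    (deg f : ℚ) < s := by
  by_cases hf0 : f = 0
  · simpa [hf0] using hs
  by_contra! hle
  rcases hle.eq_or_lt with heq | hlt
  · exact coeffAt_deg_ne_zero hf0 (heq ▸ hc)
  · exact coeffAt_deg_ne_zero hf0 (hf _ hlt)

theorem mul_mem_degLE (hf : f ∈ degLE s) (hg : g ∈ degLE t) : f * g ∈ degLE (s + t) := by
  rcases lt_or_ge s 0 with hs | hs
  · simp [eq_zero_of_mem_degLE_of_neg hf hs]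
  rcases lt_or_ge t 0 with ht | ht
  · simp [eq_zero_of_mem_degLE_of_neg hg ht]
  lift s to ℚ≥0 using hs
  lift t to ℚ≥0 using ht
  rw [mem_degLE_coe] at hf hg
  rw [← NNRat.cast_add, mem_degLE_coe]
  exact (AddMonoidAlgebra.supDegree_mul_le fun _ _ => rfl).trans (add_le_add hf hg)

theorem coeffAt_mul (hf : f ∈ degLE s) (hg : g ∈ degLE t) :
    coeffAt (s + t) (f * g) = coeffAt s f * coeffAt t g := by
  rcases lt_or_ge s 0 with hs | hs
  · simp [eq_zero_of_mem_degLE_of_neg hf hs]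
  rcases lt_or_ge t 0 with ht | ht
  · simp [eq_zero_of_mem_degLE_of_neg hg ht]
  lift s to ℚ≥0 using hs
  lift t to ℚ≥0 using ht
  rw [mem_degLE_coe] at hf hg
  rw [← NNRat.cast_add, coeffAt_coe, coeffAt_coe, coeffAt_coe]
  exact AddMonoidAlgebra.coeff_add_of_supDegree_le (fun _ _ => rfl) Function.injective_id hf hg

theorem single_mem_degLE (s : ℚ≥0) (c : RealAlg) : single s c ∈ degLE s := by
  classical
  rw [mem_degLE_coe, deg, AddMonoidAlgebra.supDegree_single]
  split_ifs <;> simp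

theorem coeffAt_single (s : ℚ≥0) (c : RealAlg) : coeffAt s (single s c) = c := by
  simp [coeffAt_coe]

theorem one_mem_degLE : (1 : FracPoly) ∈ degLE 0 := by
  simpa [AddMonoidAlgebra.one_def] using single_mem_degLE 0 1

theorem coeffAt_one : coeffAt 0 (1 : FracPoly) = 1 := by
  simpa [AddMonoidAlgebra.one_def] using coeffAt_single 0 1

theorem pow_mem_degLE (hf : f ∈ degLE s) (n : ℕ) : f ^ n ∈ degLE (n * s) := by
  induction n with
  | zero => simpa using one_mem_degLE
  | succ n ih => simpa [pow_succ, add_mul] using mul_mem_degLE ih hf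

theorem coeffAt_pow (hf : f ∈ degLE s) (n : ℕ) : coeffAt (n * s) (f ^ n) = coeffAt s f ^ n := by
  induction n with
  | zero => simpa using coeffAt_one
  | succ n ih => simpa [pow_succ, add_mul, ih] using coeffAt_mul (pow_mem_degLE hf n) hf

theorem nonneg_of_coeffAt_pos (hf : f ∈ degLE s) (hc : 0 < coeffAt s f) : Nonneg f := by
  have hs : 0 ≤ s := by
    by_contra! hs
    exact hc.ne' (coeffAt_of_neg hs f)
  lift s to ℚ≥0 using hs
  rw [coeffAt_coe] at hc
  refine Or.inr ⟨s, hc, fun t ht => ?_⟩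
  rw [← coeffAt_coe, hf t (NNRat.cast_lt.2 ht)]

theorem nonneg_iff_coeffAt_deg : Nonneg f ↔ 0 ≤ coeffAt (deg f) f := by
  constructor
  · rintro (rfl | ⟨r, hr, hr'⟩)
    · simp
    have hf : f ∈ degLE r := mem_degLE_coe.2 <| Finset.sup_le fun t ht => by
      by_contra! hrt
      exact Finsupp.mem_support_iff.1 ht (hr' t hrt)
    rw [← coeffAt_coe] at hr
    have hdeg : deg f = r := (mem_degLE_coe.1 hf).antisymm <| not_lt.1 fun hlt =>
      hr.ne' (by rw [mem_degLE_deg f r (NNRat.cast_lt.2 hlt)]; rfl)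
    exact hdeg ▸ hr.le
  · intro h
    by_cases hf : f = 0
    · exact Or.inl hf
    · exact nonneg_of_coeffAt_pos (mem_degLE_deg f) (h.lt_of_ne' (coeffAt_deg_ne_zero hf))

theorem coeffAt_deg_neg (f : FracPoly) : coeffAt (deg (-f)) (-f) = -coeffAt (deg f) f := by
  rw [deg, AddMonoidAlgebra.supDegree_neg, map_neg]

/-- The positive cone of the order of `FracPoly`. -/
def nonnegCone : RingCone FracPoly where
  carrier := {f | Nonneg f}
  zero_mem' := Or.inl rfl
  add_mem' := Nonneg.add
  one_mem' := nonneg_of_coeffAt_pos one_mem_degLE (by simp [coeffAt_one])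
  mul_mem' := Nonneg.mul
  eq_zero_of_mem_of_neg_mem' {f} hf hf' := by
    rw [Set.mem_ofPred_eq, nonneg_iff_coeffAt_deg] at hf hf'
    rw [coeffAt_deg_neg, neg_nonneg] at hf'
    by_contra hne
    exact coeffAt_deg_ne_zero hne (hf'.antisymm hf)

instance : HasMemOrNegMem nonnegCone where
  mem_or_neg_mem f := by
    change Nonneg f ∨ Nonneg (-f)
    rw [nonneg_iff_coeffAt_deg, nonneg_iff_coeffAt_deg, coeffAt_deg_neg, neg_nonneg]
    exact le_total _ _

open Classical in
noncomputable instance : LinearOrder FracPoly := .mkOfAddGroupCone nonnegCone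

instance : IsOrderedRing FracPoly := .mkOfCone nonnegCone

instance : IsStrictOrderedRing FracPoly := IsOrderedRing.toIsStrictOrderedRing _

theorem le_iff_nonneg_sub : f ≤ g ↔ Nonneg (g - f) := Iff.rfl

theorem pos_of_coeffAt_pos (hf : f ∈ degLE s) (hc : 0 < coeffAt s f) : 0 < f := by
  refine lt_of_le_of_ne ?_ ?_
  · rw [le_iff_nonneg_sub, sub_zero]
    exact nonneg_of_coeffAt_pos hf hc
  · rintro rfl
    simp at hc

theorem sign_eq_sign_coeffAt (hf : f ∈ degLE s) (hc : coeffAt s f ≠ 0) :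
    sign f = sign (coeffAt s f : ℝ) := by
  change sign f = sign (coeffAt s f)
  rcases lt_or_gt_of_ne hc with h | h
  · have hneg : 0 < -f := pos_of_coeffAt_pos (neg_mem hf) (by rwa [map_neg, neg_pos])
    rw [sign_neg h, sign_neg (neg_pos.1 hneg)]
  · rw [sign_pos h, sign_pos (pos_of_coeffAt_pos hf h)]

theorem coeffAt_le_coeffAt (hf : f ∈ degLE s) (hg : g ∈ degLE s) (h : f ≤ g) :
    coeffAt s f ≤ coeffAt s g := by
  by_contra! hlt
  exact h.not_gt (sub_pos.1 (pos_of_coeffAt_pos (sub_mem hf hg) (by rwa [map_sub, sub_pos])))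

theorem lt_of_coeffAt_lt (hf : f ∈ degLE s) (hg : g ∈ degLE s) (h : coeffAt s f < coeffAt s g) :
    f < g :=
  not_le.1 fun hle => h.not_ge (coeffAt_le_coeffAt hg hf hle)

theorem ordConnected_degLE (s : ℚ) : (degLE s : Set FracPoly).OrdConnected := by
  refine ⟨fun f hf g hg h hh => ?_⟩
  rcases lt_or_ge (deg h : ℚ) s with hs | hs
  · exact degLE_mono hs.le (mem_degLE_deg h)
  rcases hs.eq_or_lt with hs | hs
  · exact hs ▸ mem_degLE_deg h
  have hlo := coeffAt_le_coeffAt (degLE_mono hs.le hf) (mem_degLE_deg h) hh.1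
  have hhi := coeffAt_le_coeffAt (mem_degLE_deg h) (degLE_mono hs.le hg) hh.2
  rw [coeffAt_eq_zero hf hs] at hlo
  rw [coeffAt_eq_zero hg hs] at hhi
  have hh0 : h = 0 := by
    by_contra hne
    exact coeffAt_deg_ne_zero hne (hhi.antisymm hlo)
  exact hh0 ▸ zero_mem _

end Coefficients

/-! ### Tame functions -/

/-- A function on a linear order is tame on `J` if finitely many cut points decide its values there:
it takes the same value at any two points of `J` that compare in the same way with all of them. -/
def TameOn {R α : Type*} [LinearOrder R] (f : R → α) (J : Set R) : Prop :=
  ∃ C : Finset R, ∀ x ∈ J, ∀ y ∈ J, (∀ c ∈ C, cmp x c = cmp y c) → f x = f y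

namespace TameOn

variable {R S α β γ : Type*} [LinearOrder R] [LinearOrder S] {f g : R → α} {J K A : Set R}

theorem mono (h : TameOn f K) (hJ : J ⊆ K) : TameOn f J :=
  let ⟨C, hC⟩ := h
  ⟨C, fun x hx y hy => hC x (hJ hx) y (hJ hy)⟩

theorem congr (h : TameOn f J) (hfg : J.EqOn f g) : TameOn g J :=
  let ⟨C, hC⟩ := h
  ⟨C, fun x hx y hy hxy => by rw [← hfg hx, ← hfg hy, hC x hx y hy hxy]⟩

theorem const (a : α) (J : Set R) : TameOn (fun _ => a) J := ⟨∅, fun _ _ _ _ _ => rfl⟩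

theorem cmp_right (c : R) (J : Set R) : TameOn (cmp · c) J :=
  ⟨{c}, fun _ _ _ _ h => h c (Finset.mem_singleton_self c)⟩

theorem map (h : TameOn f J) (k : α → β) : TameOn (fun x => k (f x)) J :=
  let ⟨C, hC⟩ := h
  ⟨C, fun x hx y hy hxy => congrArg k (hC x hx y hy hxy)⟩

theorem map₂ {g : R → β} (hf : TameOn f J) (hg : TameOn g J) (k : α → β → γ) :
    TameOn (fun x => k (f x) (g x)) J := by
  classical
  obtain ⟨C, hC⟩ := hf
  obtain ⟨D, hD⟩ := hg
  refine ⟨C ∪ D, fun x hx y hy hxy => congrArg₂ k (hC x hx y hy fun c hc => ?_)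
    (hD x hx y hy fun c hc => ?_)⟩
  · exact hxy c (Finset.mem_union_left D hc)
  · exact hxy c (Finset.mem_union_right C hc)

theorem of_inter_of_diff (hA : TameOn (· ∈ A) J) (hin : TameOn f (J ∩ A))
    (hout : TameOn f (J \ A)) : TameOn f J := by
  classical
  obtain ⟨C, hC⟩ := hA
  obtain ⟨D, hD⟩ := hin
  obtain ⟨E, hE⟩ := hout
  refine ⟨C ∪ (D ∪ E), fun x hx y hy hxy => ?_⟩
  have hiff : x ∈ A ↔ y ∈ A := (hC x hx y hy fun c hc => hxy c (by simp [hc])).to_iff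
  by_cases hxA : x ∈ A
  · exact hD x ⟨hx, hxA⟩ y ⟨hy, hiff.1 hxA⟩ fun c hc => hxy c (by simp [hc])
  · exact hE x ⟨hx, hxA⟩ y ⟨hy, mt hiff.2 hxA⟩ fun c hc => hxy c (by simp [hc])

theorem comp {e : S → R} {I : Set S} (hf : TameOn f J) (hIJ : I.MapsTo e J)
    (he : ∀ c, TameOn (fun x => cmp (e x) c) I) : TameOn (fun x => f (e x)) I := by
  classical
  obtain ⟨C, hC⟩ := hf
  choose D hD using he
  refine ⟨C.biUnion D, fun x hx y hy hxy => hC _ (hIJ hx) _ (hIJ hy) fun c hc => ?_⟩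
  exact hD c x hx y hy fun d hd => hxy d (Finset.mem_biUnion.2 ⟨c, hc, hd⟩)

theorem mem_Ioo (a b : R) (J : Set R) : TameOn (· ∈ Set.Ioo a b) J := by
  refine ((cmp_right a J).map₂ (cmp_right b J) fun o o' => o = .gt ∧ o' = .lt).congr ?_
  intro x _
  simp [cmp_eq_gt_iff, cmp_eq_lt_iff]

theorem sign_id [Zero R] (J : Set R) : TameOn (sign : R → SignType) J := by
  refine ((cmp_right 0 J).map fun o => if o = .gt then 1 else if o = .lt then -1 else 0).congr ?_
  intro x _
  simp [sign_apply, cmp_eq_gt_iff, cmp_eq_lt_iff]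

end TameOn

/-- The formal sums of degree at most `r` whose coefficient at `r` lies in `U`. -/
def band (r : ℚ≥0) (U : Set ℝ) : Set FracPoly := {x | x ∈ degLE r ∧ (coeffAt r x : ℝ) ∈ U}

theorem band_mono {r : ℚ≥0} {U V : Set ℝ} (h : U ⊆ V) : band r U ⊆ band r V :=
  fun _ hx => ⟨hx.1, h hx.2⟩

theorem Ioo_single_subset_band (r : ℚ≥0) (a b : RealAlg) :
    Set.Ioo (single r a) (single r b) ⊆ band r (Set.Icc a b) := by
  intro x hx
  have hxr : x ∈ degLE r := (ordConnected_degLE r).out (single_mem_degLE r a)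
    (single_mem_degLE r b) ⟨hx.1.le, hx.2.le⟩
  refine ⟨hxr, ?_, ?_⟩
  · simpa [coeffAt_single] using coeffAt_le_coeffAt (single_mem_degLE r a) hxr hx.1.le
  · simpa [coeffAt_single] using coeffAt_le_coeffAt hxr (single_mem_degLE r b) hx.2.le

theorem band_Ioo_subset_Ioo_single (r : ℚ≥0) (a b : RealAlg) :
    band r (Set.Ioo a b) ⊆ Set.Ioo (single r a) (single r b) := by
  rintro x ⟨hxr, hax, hxb⟩
  refine ⟨lt_of_coeffAt_lt (single_mem_degLE r a) hxr ?_,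
    lt_of_coeffAt_lt hxr (single_mem_degLE r b) ?_⟩
  · simpa [coeffAt_single] using hax
  · simpa [coeffAt_single] using hxb

theorem exists_realAlg_btwn {x y : ℝ} (h : x < y) : ∃ a : RealAlg, x < a ∧ a < y :=
  let ⟨q, hxq, hqy⟩ := exists_rat_btwn h
  ⟨q, by simpa using hxq, by simpa using hqy⟩

theorem exists_tameOn_of_isCompact {α : Type*} {f : FracPoly → α} {r : ℚ≥0} {K : Set ℝ}
    (hK : IsCompact K) (hf : ∀ c ∈ K, ∃ U ∈ 𝓝 c, TameOn f (band r U)) :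
    ∃ J, band r K ⊆ J ∧ TameOn (· ∈ J) Set.univ ∧ TameOn f J := by
  refine hK.induction_on (p := fun K => ∃ J, band r K ⊆ J ∧ TameOn (· ∈ J) Set.univ ∧ TameOn f J)
    ?_ ?_ ?_ ?_
  · exact ⟨∅, fun _ hx => hx.2.elim, .const False _, ∅, fun _ hx => hx.elim⟩
  · rintro K L hKL ⟨J, hJ, hmem, hfJ⟩
    exact ⟨J, (band_mono hKL).trans hJ, hmem, hfJ⟩
  · rintro K L ⟨I, hI, hImem, hfI⟩ ⟨J, hJ, hJmem, hfJ⟩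
    refine ⟨I ∪ J, ?_, hImem.map₂ hJmem Or, ?_⟩
    · rintro x ⟨hxr, hxK | hxL⟩
      exacts [Or.inl (hI ⟨hxr, hxK⟩), Or.inr (hJ ⟨hxr, hxL⟩)]
    · refine (hImem.mono (Set.subset_univ _)).of_inter_of_diff (hfI.mono Set.inter_subset_right)
        (hfJ.mono ?_)
      rw [Set.union_sdiff_left]
      exact Set.sdiff_subset
  · intro c hc
    obtain ⟨U, hU, hfU⟩ := hf c hc
    obtain ⟨l, u, ⟨hlc, hcu⟩, hlu⟩ := mem_nhds_iff_exists_Ioo_subset.1 hU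
    obtain ⟨a, hla, hac⟩ := exists_realAlg_btwn hlc
    obtain ⟨b, hcb, hbu⟩ := exists_realAlg_btwn hcu
    refine ⟨Set.Ioo a b, mem_nhdsWithin_of_mem_nhds (Ioo_mem_nhds hac hcb),
      Set.Ioo (single r a) (single r b), band_Ioo_subset_Ioo_single r a b, .mem_Ioo _ _ _,
      hfU.mono ((Ioo_single_subset_band r a b).trans (band_mono ?_))⟩
    exact (Set.Icc_subset_Ioo hla hbu).trans hlu

/-! ### Polynomials over ordered fields -/

section PolynomialSign

variable {𝕜 : Type*} [Field 𝕜] [LinearOrder 𝕜] [IsStrictOrderedRing 𝕜] [TopologicalSpace 𝕜]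
  [OrderTopology 𝕜]

theorem eventually_sign_eval_eq {φ : 𝕜[X]} {c : 𝕜} (hc : φ.eval c ≠ 0) :
    ∀ᶠ x in 𝓝 c, sign (φ.eval x) = sign (φ.eval c) :=
  have hcont : ContinuousAt (fun x => sign (φ.eval x)) c :=
    (continuousAt_sign_of_ne_zero hc).comp (f := (φ.eval ·)) φ.continuous.continuousAt
  hcont.eventually_mem ((isOpen_discrete {sign (φ.eval c)}).mem_nhds rfl)

theorem eventually_sign_eval_eq_trailing (φ : 𝕜[X]) :
    ∀ᶠ x in 𝓝 0, sign (φ.eval x) = sign φ.trailingCoeff * sign x ^ φ.natTrailingDegree := by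
  by_cases hφ : φ = 0
  · simp [hφ]
  set d := φ.natTrailingDegree with hd
  obtain ⟨ψ, hψ⟩ : X ^ d ∣ φ :=
    X_pow_dvd_iff.2 fun i hi => coeff_eq_zero_of_lt_natTrailingDegree hi
  have hψ0 : ψ.eval 0 = φ.trailingCoeff := by
    rw [← coeff_zero_eq_eval_zero, trailingCoeff, ← hd, ← coeff_X_pow_mul ψ d 0, zero_add, ← hψ]
  filter_upwards [eventually_sign_eval_eq (hψ0.trans_ne (trailingCoeff_nonzero_iff_nonzero.2 hφ))]
    with x hx
  conv_lhs => rw [hψ]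
  rw [eval_mul, eval_pow, eval_X, sign_mul, sign_pow, hx, hψ0, mul_comm]

theorem exists_sign_eval_eq_leading (φ : 𝕜[X]) :
    ∃ M ≥ 0, ∀ x, M < |x| → sign (φ.eval x) = sign φ.leadingCoeff * sign x ^ φ.natDegree := by
  by_cases hφ : φ = 0
  · exact ⟨0, le_rfl, by simp [hφ]⟩
  have hrev : φ.reverse.eval 0 = φ.leadingCoeff := by
    rw [← coeff_zero_eq_eval_zero, coeff_zero_reverse]
  obtain ⟨ε, hε, hsign⟩ := (nhds_basis_abs_sub_lt (0 : 𝕜)).eventually_iff.1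
    (eventually_sign_eval_eq (hrev.trans_ne (leadingCoeff_ne_zero.2 hφ)))
  refine ⟨ε⁻¹, (inv_pos.2 hε).le, fun x hx => ?_⟩
  have hx0 : x ≠ 0 := abs_pos.1 ((inv_pos.2 hε).trans hx)
  let := invertibleOfNonzero hx0
  have hmul : φ.reverse.eval x⁻¹ * x ^ φ.natDegree = φ.eval x := by
    rw [← invOf_eq_inv]
    exact eval₂_reverse_mul_pow (RingHom.id 𝕜) x φ
  have hinv : |x⁻¹ - 0| < ε := by
    rw [sub_zero, abs_inv]
    exact inv_lt_of_inv_lt₀ hε hx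
  rw [← hmul, sign_mul, sign_pow, hsign hinv, hrev]

end PolynomialSign

theorem rootMultiplicity_lt_natDegree {R : Type*} [CommRing R] [IsDomain R] [CharZero R] {φ : R[X]}
    (hφ : φ ≠ 0) (hnext : φ.nextCoeff = 0) (htrailing : φ.natTrailingDegree < φ.natDegree) (a : R) :
    φ.rootMultiplicity a < φ.natDegree := by
  have hdvd := pow_rootMultiplicity_dvd φ a
  have hle : φ.rootMultiplicity a ≤ φ.natDegree := by
    simpa using natDegree_le_of_dvd hdvd hφ
  refine hle.lt_of_ne fun heq => ?_
  obtain ⟨u, hu⟩ : ∃ u, φ = (X - C a) ^ φ.natDegree * C u := by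
    obtain ⟨ψ, hψ⟩ := heq ▸ hdvd
    have hψ0 : ψ ≠ 0 := by rintro rfl; exact hφ (by simpa using hψ)
    have hdeg := congrArg natDegree hψ
    rw [natDegree_mul (pow_ne_zero _ (X_sub_C_ne_zero a)) hψ0, natDegree_pow, natDegree_X_sub_C,
      mul_one, left_eq_add] at hdeg
    exact ⟨ψ.coeff 0, by rwa [← eq_C_of_natDegree_eq_zero hdeg]⟩
  have hu0 : u ≠ 0 := by rintro rfl; exact hφ (by simpa using hu)
  have hd : (φ.natDegree : R) ≠ 0 := Nat.cast_ne_zero.2 (Nat.ne_zero_of_lt htrailing)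
  have ha : a = 0 := by
    rw [hu, nextCoeff_mul_C, (monic_X_sub_C a).nextCoeff_pow, nextCoeff_X_sub_C] at hnext
    simpa [hu0, hd] using hnext
  have hX : φ = monomial φ.natDegree u := by
    rwa [ha, C_0, sub_zero, mul_comm, C_mul_X_pow_eq_monomial] at hu
  exact htrailing.ne (by conv_lhs => rw [hX, natTrailingDegree_monomial hu0])

/-! ### Weights and initial forms -/

/-- Giving `X ^ s` the weight `s` and the variable of `p` the weight `r`, no term of `p` has a
weight exceeding `m`. -/
def WeightLE (m r : ℚ) (p : FracPoly[X]) : Prop := ∀ i : ℕ, p.coeff i ∈ degLE (m - i * r)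

/-- The part of `p` of weight `m`, when the variable has the weight `r`. Its coefficients are
regarded as real numbers, so that it can be studied by topological means. -/
noncomputable def initialForm (m r : ℚ) (p : FracPoly[X]) : ℝ[X] :=
  ∑ i ∈ Finset.range (p.natDegree + 1), monomial i (coeffAt (m - i * r) (p.coeff i) : ℝ)

section Weights

variable {m r : ℚ} {p : FracPoly[X]} {x : FracPoly}

theorem coeff_initialForm (m r : ℚ) (p : FracPoly[X]) (i : ℕ) :
    (initialForm m r p).coeff i = coeffAt (m - i * r) (p.coeff i) := by
  simp only [initialForm, finsetSum_coeff, coeff_monomial, Finset.sum_ite_eq', Finset.mem_range]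
  split_ifs with hi
  · rfl
  · rw [coeff_eq_zero_of_natDegree_lt (by omega), map_zero, ZeroMemClass.coe_zero]

theorem WeightLE.eval_mem_degLE (hp : WeightLE m r p) (hx : x ∈ degLE r) : p.eval x ∈ degLE m := by
  rw [eval_eq_sum_range]
  refine sum_mem fun i _ => ?_
  simpa using mul_mem_degLE (hp i) (pow_mem_degLE hx i)

theorem WeightLE.coeffAt_eval (hp : WeightLE m r p) (hx : x ∈ degLE r) :
    (coeffAt m (p.eval x) : ℝ) = (initialForm m r p).eval (coeffAt r x : ℝ) := by
  rw [eval_eq_sum_range, map_sum, AddSubmonoidClass.coe_finsetSum, initialForm, eval_finsetSum]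
  refine Finset.sum_congr rfl fun i _ => ?_
  have hmul := coeffAt_mul (hp i) (pow_mem_degLE hx i)
  rw [sub_add_cancel, coeffAt_pow hx] at hmul
  simp [hmul]

theorem WeightLE.sign_eval (hp : WeightLE m r p) (hx : x ∈ degLE r)
    (h0 : (initialForm m r p).eval (coeffAt r x : ℝ) ≠ 0) :
    sign (p.eval x) = sign ((initialForm m r p).eval (coeffAt r x : ℝ)) := by
  rw [← hp.coeffAt_eval hx] at h0 ⊢
  exact sign_eq_sign_coeffAt (hp.eval_mem_degLE hx) (by simpa using h0)

theorem WeightLE.sign_eval_eq_mul_pow {d : ℕ} {u : ℝ} (hp : WeightLE m r p) (hu : u ≠ 0)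
    (hx : x ∈ degLE r) (hx0 : coeffAt r x ≠ 0)
    (h : sign ((initialForm m r p).eval (coeffAt r x : ℝ)) = sign u * sign (coeffAt r x : ℝ) ^ d) :
    sign (p.eval x) = sign u * sign x ^ d := by
  rw [sign_eq_sign_coeffAt hx hx0, ← h]
  refine hp.sign_eval hx (sign_ne_zero.1 (h.trans_ne ?_))
  exact mul_ne_zero (sign_ne_zero.2 hu) (pow_ne_zero d (sign_ne_zero.2 (by simpa using hx0)))

theorem WeightLE.sign_eval_of_monomial {d : ℕ} {u : ℝ} (hp : WeightLE m r p) (hu : u ≠ 0)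
    (hinit : initialForm m r p = monomial d u) (hx : x ∈ degLE r) (hx0 : coeffAt r x ≠ 0) :
    sign (p.eval x) = sign u * sign x ^ d :=
  hp.sign_eval_eq_mul_pow hu hx hx0 (by rw [hinit, eval_monomial, sign_mul, sign_pow])

theorem WeightLE.hasseDeriv (hp : WeightLE m r p) (k : ℕ) :
    WeightLE (m - k * r) r (hasseDeriv k p) := by
  intro i
  have hweight : m - k * r - i * r = m - (i + k : ℕ) * r := by push_cast; ring
  rw [hasseDeriv_coeff, hweight, ← nsmul_eq_mul _ (p.coeff _)]
  exact nsmul_mem (hp (i + k)) _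

theorem initialForm_hasseDeriv (m r : ℚ) (p : FracPoly[X]) (k : ℕ) :
    initialForm (m - k * r) r (Polynomial.hasseDeriv k p) =
      Polynomial.hasseDeriv k (initialForm m r p) := by
  ext i
  have hweight : m - k * r - i * r = m - (i + k : ℕ) * r := by push_cast; ring
  rw [coeff_initialForm, hasseDeriv_coeff, hasseDeriv_coeff, coeff_initialForm, hweight,
    ← nsmul_eq_mul _ (p.coeff _), map_nsmul]
  simp

theorem WeightLE.taylor (hp : WeightLE m r p) (hx : x ∈ degLE r) : WeightLE m r (taylor x p) := by
  intro i
  rw [taylor_coeff]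
  exact (hp.hasseDeriv i).eval_mem_degLE hx

theorem WeightLE.initialForm_taylor (hp : WeightLE m r p) (hx : x ∈ degLE r) :
    initialForm m r (Polynomial.taylor x p) =
      Polynomial.taylor (coeffAt r x : ℝ) (initialForm m r p) := by
  ext i
  rw [coeff_initialForm, taylor_coeff, taylor_coeff, (hp.hasseDeriv i).coeffAt_eval hx,
    initialForm_hasseDeriv]

theorem exists_realAlg_of_eval_initialForm_eq_zero (h0 : initialForm m r p ≠ 0) {c : ℝ}
    (hc : (initialForm m r p).eval c = 0) : ∃ a : RealAlg, (a : ℝ) = c := by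
  obtain ⟨φ, hφ⟩ : ∃ φ : RealAlg[X], φ.map (algebraMap RealAlg ℝ) = initialForm m r p :=
    (mem_lifts _).1 ((lifts_iff_coeff_lifts _).2 fun i => ⟨_, (coeff_initialForm m r p i).symm⟩)
  have hφ0 : φ ≠ 0 := by rintro rfl; exact h0 (by simpa using hφ.symm)
  have halg : IsAlgebraic RealAlg c := ⟨φ, hφ0, by rw [← eval_map_algebraMap, hφ, hc]⟩
  have : Algebra.IsAlgebraic ℚ RealAlg := algebraicClosure.isAlgebraic ℚ ℝ
  exact ⟨⟨c, mem_algebraicClosure_iff.2 (halg.restrictScalars ℚ)⟩, rfl⟩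

end Weights

/-! ### Approximate simple roots -/

/-- The formal sums whose exponents all lie in `Γ`. -/
def exponentsIn (Γ : AddSubmonoid ℚ≥0) : Subring FracPoly where
  carrier := {f | ∀ s, f.coeff s ≠ 0 → s ∈ Γ}
  zero_mem' s hs := absurd rfl hs
  one_mem' s hs := by
    by_contra hs0
    exact hs (Finsupp.single_eq_of_ne fun h => hs0 (h ▸ zero_mem Γ))
  add_mem' {f g} hf hg s hs := by
    by_cases hfs : f.coeff s = 0
    · exact hg s (by simpa [hfs] using hs)
    · exact hf s hfs
  neg_mem' hf s hs := hf s (by simpa using hs)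
  mul_mem' {f g} hf hg s hs := by
    classical
    obtain ⟨a, ha, b, hb, rfl⟩ := Finset.mem_add.1
      (AddMonoidAlgebra.support_coeff_mul_subset f g (Finsupp.mem_support_iff.2 hs))
    exact add_mem (hf a (Finsupp.mem_support_iff.1 ha)) (hg b (Finsupp.mem_support_iff.1 hb))

theorem exists_forall_coeff_mem_exponentsIn (p : FracPoly[X]) :
    ∃ N : ℕ, ∀ i, p.coeff i ∈ exponentsIn (AddSubmonoid.multiples (N : ℚ≥0)⁻¹) := by
  classical
  set S := p.support.biUnion fun i => (p.coeff i).coeff.support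
  refine ⟨∏ s ∈ S, s.den, fun i s hs => ?_⟩
  have hsS : s ∈ S := by
    refine Finset.mem_biUnion.2 ⟨i, mem_support_iff.2 fun h0 => hs ?_, Finsupp.mem_support_iff.2 hs⟩
    rw [h0]
    rfl
  obtain ⟨k, hk⟩ : s.den ∣ ∏ s ∈ S, s.den := Finset.dvd_prod_of_mem _ hsS
  have hk0 : (k : ℚ≥0) ≠ 0 := by
    rintro hk0
    have hpos := Finset.prod_pos fun s (_ : s ∈ S) => s.den_pos
    simp [hk, Nat.cast_eq_zero.1 hk0] at hpos
  refine (AddSubmonoid.mem_multiples_iff _ _).2 ⟨k * s.num, ?_⟩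
  conv_rhs => rw [← NNRat.num_div_den s]
  have hden : (s.den : ℚ≥0) ≠ 0 := Nat.cast_ne_zero.2 s.den_pos.ne'
  rw [hk, nsmul_eq_mul]
  push_cast
  field_simp

theorem single_mem_exponentsIn {Γ : AddSubmonoid ℚ≥0} {s : ℚ≥0} (hs : s ∈ Γ) (c : RealAlg) :
    single s c ∈ exponentsIn Γ := by
  intro t ht
  by_contra htΓ
  exact ht (Finsupp.single_eq_of_ne fun h => htΓ (h ▸ hs))

theorem deg_mem_of_mem_exponentsIn {Γ : AddSubmonoid ℚ≥0} {f : FracPoly} (hf : f ∈ exponentsIn Γ) :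
    deg f ∈ Γ := by
  by_cases hf0 : f = 0
  · simp [hf0]
  · exact hf _ (by simpa only [coeffAt_coe] using coeffAt_deg_ne_zero hf0)

theorem mem_multiples_of_add_mem {a s t : ℚ≥0} (ht : t ∈ AddSubmonoid.multiples a)
    (hst : s + t ∈ AddSubmonoid.multiples a) : s ∈ AddSubmonoid.multiples a := by
  obtain ⟨j, rfl⟩ := ht
  obtain ⟨k, hk⟩ := hst
  refine (AddSubmonoid.mem_multiples_iff _ _).2 ⟨k - j, ?_⟩
  rw [eq_tsub_of_add_eq hk.symm]
  simp only [nsmul_eq_mul, Nat.cast_tsub, tsub_mul]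

theorem eval_mem_exponentsIn {Γ : AddSubmonoid ℚ≥0} {p : FracPoly[X]} {x : FracPoly}
    (hp : ∀ i, p.coeff i ∈ exponentsIn Γ) (hx : x ∈ exponentsIn Γ) :
    p.eval x ∈ exponentsIn Γ := by
  rw [eval_eq_sum_range]
  exact sum_mem fun i _ => mul_mem (hp i) (pow_mem hx i)

theorem WeightLE.exists_deg_eval_single_lt {m r : ℚ} {p : FracPoly[X]} (hp : WeightLE m r p)
    (h1 : coeffAt (m - r) (p.coeff 1) ≠ 0) (hlt : m - r < deg (p.coeff 0))
    (hgt : deg (p.coeff 0) < m) :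
    ∃ s : ℚ≥0, s + (m - r) = deg (p.coeff 0) ∧
      ∃ c, deg (p.eval (single s c)) < deg (p.coeff 0) := by
  set t := deg (p.coeff 0)
  set u := coeffAt (m - r) (p.coeff 1) with hu
  set a := coeffAt t (p.coeff 0) with ha
  obtain ⟨s, hs⟩ : ∃ s : ℚ≥0, (s : ℚ) = t - (m - r) := CanLift.prf _ (sub_nonneg.2 hlt.le)
  have hm : 0 ≤ m - r := not_lt.1 fun hneg => h1 (coeffAt_of_neg hneg _)
  have hsr : (s : ℚ) < r := by linarith
  have hweight : ∀ i : ℕ, m - (i + 2 : ℕ) * r < t - (i + 2 : ℕ) * s := by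
    intro i
    push_cast
    nlinarith [mul_le_mul_of_nonneg_left hsr.le i.cast_nonneg]
  have hp' : WeightLE t s p
    | 0 => by simpa using mem_degLE_deg (p.coeff 0)
    | 1 => degLE_mono (by push_cast; linarith) (hp 1)
    | i + 2 => degLE_mono (hweight i).le (hp (i + 2))
  have hform : initialForm t s p = C (a : ℝ) + C (u : ℝ) * X := by
    ext i
    rw [coeff_initialForm]
    match i with
    | 0 => simp [ha]
    | 1 => simp [hu, hs]
    | i + 2 => rw [coeffAt_eq_zero (hp (i + 2)) (hweight i)]; simp
  refine ⟨s, by linarith, -a / u, ?_⟩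
  have hmem := hp'.eval_mem_degLE (single_mem_degLE s (-a / u))
  have hcoeff := hp'.coeffAt_eval (single_mem_degLE s (-a / u))
  refine NNRat.cast_lt.1 (deg_lt_of_coeffAt_eq_zero hmem ?_ (hm.trans_lt hlt))
  rw [hform, coeffAt_single] at hcoeff
  have hu' : (u : ℝ) ≠ 0 := by simpa using h1
  simpa [mul_div_cancel₀, hu'] using hcoeff

theorem WeightLE.exists_deg_eval_add_single_lt {m : ℚ} {r : ℚ≥0} {p : FracPoly[X]} {b : FracPoly}
    (hp : WeightLE m r p) (h0 : (initialForm m r p).coeff 0 = 0)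
    (h1 : (initialForm m r p).coeff 1 ≠ 0) (hb : b ∈ degLE r) (hb0 : coeffAt r b = 0)
    (hlt : m - r < deg (p.eval b)) :
    ∃ s < r, s + (m - r) = deg (p.eval b) ∧
      ∃ c, deg (p.eval (b + single s c)) < deg (p.eval b) := by
  set q := Polynomial.taylor b p with hq
  have hq0 : q.coeff 0 = p.eval b := taylor_coeff_zero b p
  have hform : initialForm m r q = initialForm m r p := by simp [q, hp.initialForm_taylor hb, hb0]
  have hq1 : coeffAt (m - r) (q.coeff 1) ≠ 0 := by
    rw [← hform, coeff_initialForm] at h1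
    simpa using h1
  have hr : 0 ≤ m - r := not_lt.1 fun hneg => hq1 (coeffAt_of_neg hneg _)
  have hpos : 0 < m := by
    by_contra! hm
    have hdeg := mem_degLE_coe.1 (degLE_mono (hm.trans NNRat.cast_zero.ge) (hp.eval_mem_degLE hb))
    exact hlt.not_ge ((NNRat.cast_nonpos.2 hdeg).trans hr)
  have hgt : deg (p.eval b) < m := by
    refine deg_lt_of_coeffAt_eq_zero (hp.eval_mem_degLE hb) ?_ hpos
    have hcoeff := hp.coeffAt_eval hb
    rw [hb0, ZeroMemClass.coe_zero, ← coeff_zero_eq_eval_zero, h0] at hcoeff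
    simpa using hcoeff
  obtain ⟨s, hs, c, hdeg⟩ :=
    (hp.taylor hb).exists_deg_eval_single_lt hq1 (by rwa [hq0]) (by rwa [hq0])
  rw [← hq, hq0] at hs hdeg
  rw [hq, taylor_eval, add_comm] at hdeg
  exact ⟨s, NNRat.cast_lt.1 (by linarith : (s : ℚ) < r), hs, c, hdeg⟩

/-- Newton's method: a `b` which fails to satisfy `p.eval b ∈ degLE (m - r)` is corrected by one
term, which lowers the degree of `p.eval b`. That degree stays in a discrete set of exponents. -/
theorem WeightLE.exists_eval_mem_degLE {m : ℚ} {r : ℚ≥0} {p : FracPoly[X]} (hp : WeightLE m r p)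
    (h0 : (initialForm m r p).coeff 0 = 0) (h1 : (initialForm m r p).coeff 1 ≠ 0) :
    ∃ b ∈ degLE r, coeffAt r b = 0 ∧ p.eval b ∈ degLE (m - r) := by
  obtain ⟨N, hpN⟩ := exists_forall_coeff_mem_exponentsIn p
  set Γ := AddSubmonoid.multiples (N : ℚ≥0)⁻¹
  have h1' : coeffAt (m - r) (p.coeff 1) ≠ 0 := by simpa [coeff_initialForm] using h1
  obtain ⟨e, he⟩ : ∃ e : ℚ≥0, (e : ℚ) = m - r :=
    CanLift.prf _ (not_lt.1 fun hneg => h1' (coeffAt_of_neg hneg _))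
  have heN : e ∈ Γ := hpN 1 e (by rwa [← coeffAt_coe, he])
  suffices ∀ k : ℕ, ∀ b ∈ exponentsIn Γ, b ∈ degLE r → coeffAt r b = 0 →
      deg (p.eval b) = k • (N : ℚ≥0)⁻¹ →
      ∃ b ∈ degLE r, coeffAt r b = 0 ∧ p.eval b ∈ degLE (m - r) by
    obtain ⟨k, hk⟩ := deg_mem_of_mem_exponentsIn (eval_mem_exponentsIn hpN (zero_mem _))
    exact this k 0 (zero_mem _) (zero_mem _) (map_zero _) hk.symm
  intro k
  induction k using Nat.strong_induction_on with | _ k ih => ?_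
  intro b hbN hb hb0 hk
  by_cases hlt : m - r < deg (p.eval b)
  swap
  · exact ⟨b, hb, hb0, degLE_mono (not_lt.1 hlt) (mem_degLE_deg _)⟩
  obtain ⟨s, hsr, hs, c, hdeg⟩ := hp.exists_deg_eval_add_single_lt h0 h1 hb hb0 hlt
  have hse : s + e = k • (N : ℚ≥0)⁻¹ :=
    NNRat.cast_injective (α := ℚ) (by rw [NNRat.cast_add, he, hs, hk])
  have hsN : s ∈ Γ := mem_multiples_of_add_mem heN ⟨k, hse.symm⟩
  have hmem := add_mem hbN (single_mem_exponentsIn hsN c)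
  obtain ⟨k', hk'⟩ := deg_mem_of_mem_exponentsIn (eval_mem_exponentsIn hpN hmem)
  have hsr' : (s : ℚ) < r := NNRat.cast_lt.2 hsr
  refine ih k' ?_ _ hmem (add_mem hb (degLE_mono hsr'.le (single_mem_degLE s c))) ?_ hk'.symm
  · rw [hk, ← hk'] at hdeg
    exact lt_of_smul_lt_smul_right hdeg zero_le
  · rw [map_add, hb0, coeffAt_eq_zero (single_mem_degLE s c) hsr', zero_add]

/-! ### Tameness of polynomials -/

/-- The sign of `p` is tame at the elements of degree at most `r` whose coefficient at `r` is close
to `c`. -/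
def LocallyTame (p : FracPoly[X]) (r : ℚ≥0) (c : ℝ) : Prop :=
  ∃ U ∈ 𝓝 c, TameOn (fun x => sign (p.eval x)) (band r U)

theorem LocallyTame.of_taylor {p : FracPoly[X]} {r : ℚ≥0} {b : FracPoly} {c : ℝ} (hb : b ∈ degLE r)
    (h : LocallyTame (taylor b p) r (c - coeffAt r b)) : LocallyTame p r c := by
  obtain ⟨U, hU, htame⟩ := h
  refine ⟨(· - (coeffAt r b : ℝ)) ⁻¹' U,
    (continuous_sub_right _).continuousAt.preimage_mem_nhds hU, ?_⟩
  refine (htame.comp (e := (· - b)) ?_ fun a => ?_).congr fun x _ => ?_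
  · rintro x ⟨hxr, hxU⟩
    exact ⟨sub_mem hxr hb, by simpa using hxU⟩
  · refine (TameOn.cmp_right (a + b) _).congr fun x _ => ?_
    simp only [← cmp_add_right (x - b) a b, sub_add_cancel]
  · simp [taylor_eval]

section LocallyTame

variable {m : ℚ} {r : ℚ≥0} {p : FracPoly[X]} {c : ℝ}

theorem WeightLE.locallyTame_of_eval_ne_zero (hp : WeightLE m r p)
    (hc : (initialForm m r p).eval c ≠ 0) : LocallyTame p r c := by
  refine ⟨_, eventually_sign_eval_eq hc,
    (TameOn.const (sign ((initialForm m r p).eval c)) _).congr fun x hx => ?_⟩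
  have hsign : sign ((initialForm m r p).eval (coeffAt r x : ℝ)) = _ := hx.2
  rw [hp.sign_eval hx.1 fun h0 => ?_, hsign]
  rw [h0, sign_zero, eq_comm, sign_eq_zero_iff] at hsign
  exact hc hsign

theorem WeightLE.locallyTame_of_forall_taylor (hp : WeightLE m r p) (h0 : initialForm m r p ≠ 0)
    (h : ∀ (a : RealAlg) (q : FracPoly[X]), WeightLE m r q →
      initialForm m r q = Polynomial.taylor (a : ℝ) (initialForm m r p) → LocallyTame q r 0)
    (c : ℝ) : LocallyTame p r c := by
  by_cases hc : (initialForm m r p).eval c = 0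
  · obtain ⟨a, rfl⟩ := exists_realAlg_of_eval_initialForm_eq_zero h0 hc
    have ha := single_mem_degLE r a
    refine .of_taylor ha ?_
    rw [coeffAt_single, sub_self]
    exact h a _ (hp.taylor ha) (by rw [hp.initialForm_taylor ha, coeffAt_single])
  · exact hp.locallyTame_of_eval_ne_zero hc

theorem WeightLE.locallyTame_zero_zero (hp : WeightLE m (0 : ℚ≥0) p)
    (h0 : initialForm m (0 : ℚ≥0) p ≠ 0) :
    LocallyTame p 0 0 := by
  set φ := initialForm m (0 : ℚ≥0) p
  refine ⟨_, eventually_sign_eval_eq_trailing φ, ((TameOn.sign_id _).map fun s =>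
    if s = 0 then sign (p.eval 0) else sign φ.trailingCoeff * s ^ φ.natTrailingDegree).congr ?_⟩
  rintro x ⟨hx, hxφ : sign (φ.eval (coeffAt (0 : ℚ≥0) x : ℝ)) = _⟩
  by_cases hx0 : x = 0
  · simp [hx0]
  have hc : coeffAt (0 : ℚ≥0) x ≠ 0 := by
    simpa [← nonpos_iff_eq_zero.1 (mem_degLE_coe.1 hx)] using coeffAt_deg_ne_zero hx0
  exact (if_neg (sign_ne_zero.2 hx0)).trans
    (hp.sign_eval_eq_mul_pow (trailingCoeff_nonzero_iff_nonzero.2 h0) hx hc hxφ).symm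

theorem WeightLE.tameOn_of_locallyTame {J : Set FracPoly} (hp : WeightLE m r p)
    (h0 : initialForm m r p ≠ 0) (hloc : ∀ c, LocallyTame p r c)
    (hJ : ∀ x ∈ J, x ∉ degLE r → sign (p.eval x) =
      sign (initialForm m r p).leadingCoeff * sign x ^ (initialForm m r p).natDegree) :
    TameOn (fun x => sign (p.eval x)) J := by
  obtain ⟨M, hM0, hM⟩ := exists_sign_eval_eq_leading (initialForm m r p)
  obtain ⟨I, hI, hImem, htame⟩ :=
    exists_tameOn_of_isCompact (r := r) (isCompact_Icc (a := -M) (b := M)) fun c _ => hloc c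
  refine .of_inter_of_diff (hImem.mono (Set.subset_univ J)) (htame.mono Set.inter_subset_right)
    (((TameOn.sign_id _).map fun s => sign (initialForm m r p).leadingCoeff *
      s ^ (initialForm m r p).natDegree).congr fun x hx => ?_)
  by_cases hxr : x ∈ degLE r
  · have hxM : M < |(coeffAt r x : ℝ)| := lt_of_not_ge fun h => hx.2 (hI ⟨hxr, abs_le.1 h⟩)
    have hc : coeffAt r x ≠ 0 := fun h => hM0.not_gt (by simpa [h] using hxM)
    exact (hp.sign_eval_eq_mul_pow (leadingCoeff_ne_zero.2 h0) hxr hc (hM _ hxM)).symm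
  · exact (hJ x hx.1 hxr).symm

end LocallyTame

section NewtonPolygon

variable {p : FracPoly[X]} {d : ℕ}

theorem coeff_initialForm_vertex (e s : ℚ) (p : FracPoly[X]) (d : ℕ) :
    (initialForm (e + d * s) s p).coeff d = coeffAt e (p.coeff d) := by
  rw [coeff_initialForm, add_sub_cancel_right]

theorem initialForm_vertex_ne_zero {e : ℚ} (hd : coeffAt e (p.coeff d) ≠ 0) (s : ℚ) :
    initialForm (e + d * s) s p ≠ 0 := by
  intro h0
  have hcoeff := coeff_initialForm_vertex e s p d
  rw [h0, coeff_zero] at hcoeff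
  exact hd (by simpa using hcoeff.symm)

theorem WeightLE.coeff_initialForm_eq_zero_of_gt {e r s : ℚ} (hr : WeightLE (e + d * r) r p)
    (hsr : s < r) {i : ℕ} (hi : d < i) : (initialForm (e + d * s) s p).coeff i = 0 := by
  have hi' : (d : ℚ) < i := Nat.cast_lt.2 hi
  rw [coeff_initialForm, coeffAt_eq_zero (hr i) (by nlinarith), ZeroMemClass.coe_zero]

theorem WeightLE.coeff_initialForm_eq_zero_of_lt {e s t : ℚ} (ht : WeightLE (e + d * t) t p)
    (hts : t < s) {i : ℕ} (hi : i < d) : (initialForm (e + d * s) s p).coeff i = 0 := by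
  have hi' : (i : ℚ) < d := Nat.cast_lt.2 hi
  rw [coeff_initialForm, coeffAt_eq_zero (ht i) (by nlinarith), ZeroMemClass.coe_zero]

theorem WeightLE.initialForm_eq_monomial {e r s t : ℚ} (ht : WeightLE (e + d * t) t p)
    (hr : WeightLE (e + d * r) r p) (hts : t < s) (hsr : s < r) :
    initialForm (e + d * s) s p = monomial d (coeffAt e (p.coeff d) : ℝ) := by
  ext i
  rw [coeff_monomial]
  rcases lt_trichotomy i d with hi | rfl | hi
  · rw [ht.coeff_initialForm_eq_zero_of_lt hts hi, if_neg hi.ne']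
  · rw [coeff_initialForm_vertex, if_pos rfl]
  · rw [hr.coeff_initialForm_eq_zero_of_gt hsr hi, if_neg hi.ne]

theorem WeightLE.of_mem_Icc {e r s t : ℚ} (ht : WeightLE (e + d * t) t p)
    (hr : WeightLE (e + d * r) r p) (hs : s ∈ Set.Icc t r) : WeightLE (e + d * s) s p := by
  intro i
  rcases le_total (i : ℚ) d with hi | hi
  · exact degLE_mono (by nlinarith [hs.1]) (ht i)
  · exact degLE_mono (by nlinarith [hs.2]) (hr i)

theorem WeightLE.natDegree_initialForm {e r s : ℚ} (hr : WeightLE (e + d * r) r p)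
    (hsr : s < r) (hd : coeffAt e (p.coeff d) ≠ 0) :
    (initialForm (e + d * s) s p).natDegree = d := by
  refine natDegree_eq_of_le_of_coeff_ne_zero ?_ ?_
  · exact natDegree_le_iff_coeff_eq_zero.2 fun i hi => hr.coeff_initialForm_eq_zero_of_gt hsr hi
  · simpa [coeff_initialForm_vertex] using hd

theorem exists_newton_slope (p : FracPoly[X]) (d : ℕ) (e : ℚ≥0) :
    ∃ t : ℚ≥0, (∀ i < d, p.coeff i ∈ degLE (e + d * t - i * t)) ∧
      (t = 0 ∨ ∃ i < d, coeffAt (e + d * t - i * t) (p.coeff i) ≠ 0) := by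
  set t := (Finset.range d).sup fun i => (deg (p.coeff i) - e) / (d - i : ℕ) with ht
  have hexp : ∀ i < d, (e + d * t - i * t : ℚ) = (e + (d - i : ℕ) * t : ℚ≥0) := by
    intro i hi
    rw [NNRat.cast_add, NNRat.cast_mul, NNRat.cast_natCast, Nat.cast_sub hi.le]
    ring
  have hpos : ∀ i < d, (0 : ℚ≥0) < (d - i : ℕ) := fun i hi => Nat.cast_pos.2 (Nat.sub_pos_of_lt hi)
  refine ⟨t, fun i hi => ?_, ?_⟩
  · rw [hexp i hi, mem_degLE_coe, ← tsub_le_iff_left, mul_comm, ← div_le_iff₀ (hpos i hi)]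
    exact Finset.le_sup (f := fun i => (deg (p.coeff i) - e) / (d - i : ℕ)) (Finset.mem_range.2 hi)
  rcases (Finset.range d).eq_empty_or_nonempty with hd | hd
  · exact Or.inl (by simp [ht, hd])
  obtain ⟨i, hi, hti⟩ := Finset.exists_mem_eq_sup _ hd fun i => (deg (p.coeff i) - e) / (d - i : ℕ)
  rw [Finset.mem_range] at hi
  rcases le_total (deg (p.coeff i)) e with hle | hle
  · exact Or.inl (by rw [ht, hti, tsub_eq_zero_of_le hle, zero_div])
  refine or_iff_not_imp_left.2 fun ht0 => ⟨i, hi, ?_⟩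
  have hdeg : e + (d - i : ℕ) * t = deg (p.coeff i) := by
    rw [ht, hti, mul_div_cancel₀ _ (hpos i hi).ne', add_tsub_cancel_of_le hle]
  rw [hexp i hi, hdeg]
  refine coeffAt_deg_ne_zero fun h0 => ht0 ?_
  have hsum : e + (d - i : ℕ) * t = 0 := by rw [hdeg, h0, deg, AddMonoidAlgebra.supDegree_zero]; rfl
  exact (mul_eq_zero.1 (add_eq_zero.1 hsum).2).resolve_left (hpos i hi).ne'

end NewtonPolygon

theorem WeightLE.locallyTame_zero_of_lt {e : ℚ} {r t : ℚ≥0} {p : FracPoly[X]} {d : ℕ}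
    (hr : WeightLE (e + d * r) r p) (ht : WeightLE (e + d * t) t p) (htr : t < r)
    (hd0 : coeffAt e (p.coeff d) ≠ 0)
    (hd : (initialForm (e + d * r) r p).natTrailingDegree = d)
    (hloc : ∀ c, LocallyTame p t c) : LocallyTame p r 0 := by
  have htr' : (t : ℚ) < r := NNRat.cast_lt.2 htr
  have hu : (coeffAt e (p.coeff d) : ℝ) ≠ 0 := by simpa using hd0
  refine ⟨_, eventually_sign_eval_eq_trailing (initialForm (e + d * r) r p),
    ht.tameOn_of_locallyTame (initialForm_vertex_ne_zero hd0 t) hloc fun x hx hxt => ?_⟩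
  rw [leadingCoeff, hr.natDegree_initialForm htr' hd0, coeff_initialForm_vertex]
  obtain ⟨hxr, hsign : sign ((initialForm (e + d * r) r p).eval (coeffAt r x : ℝ)) = _⟩ := hx
  rw [trailingCoeff, hd, coeff_initialForm_vertex] at hsign
  have hx0 : x ≠ 0 := fun h0 => hxt (h0 ▸ zero_mem _)
  have hts : t < deg x := not_le.1 (mt mem_degLE_coe.2 hxt)
  rcases (mem_degLE_coe.1 hxr).eq_or_lt with rfl | hsr
  · exact hr.sign_eval_eq_mul_pow hu hxr (coeffAt_deg_ne_zero hx0) hsign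
  · have hts' : (t : ℚ) < deg x := NNRat.cast_lt.2 hts
    have hsr' : (deg x : ℚ) < r := NNRat.cast_lt.2 hsr
    exact (ht.of_mem_Icc hr ⟨hts'.le, hsr'.le⟩).sign_eval_of_monomial hu
      (ht.initialForm_eq_monomial hr hts' hsr') (mem_degLE_deg x) (coeffAt_deg_ne_zero hx0)

theorem WeightLE.exists_newton_edge {e : ℚ} {r : ℚ≥0} {p : FracPoly[X]} {d : ℕ}
    (hr : WeightLE (e + d * r) r p) (hr0 : 0 < r) (hd0 : coeffAt e (p.coeff d) ≠ 0)
    (hd : (initialForm (e + d * r) r p).natTrailingDegree = d) :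
    ∃ t < r, WeightLE (e + d * t) t p ∧
      (t = 0 ∨ (initialForm (e + d * t) t p).natTrailingDegree < d) := by
  lift e to ℚ≥0 using not_lt.1 fun hneg => hd0 (coeffAt_of_neg hneg _)
  obtain ⟨t, hlow, hattained⟩ := exists_newton_slope p d e
  have htr : t < r := by
    rcases hattained with rfl | ⟨i, hi, hne⟩
    · exact hr0
    by_contra! hrt
    have hi0 : coeffAt (e + d * r - i * r) (p.coeff i) = 0 := by
      simpa [coeff_initialForm] using coeff_eq_zero_of_lt_natTrailingDegree (hi.trans_eq hd.symm)
    rcases hrt.eq_or_lt with rfl | hrt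
    · exact hne hi0
    · have hi' : (i : ℚ) < d := Nat.cast_lt.2 hi
      have hrt' : (r : ℚ) < t := NNRat.cast_lt.2 hrt
      exact hne (coeffAt_eq_zero (hr i) (by nlinarith))
  have htr' : (t : ℚ) < r := NNRat.cast_lt.2 htr
  refine ⟨t, htr, fun i => ?_, hattained.imp_right ?_⟩
  · rcases lt_or_ge i d with hi | hi
    · exact hlow i hi
    · have hi' : (d : ℚ) ≤ i := Nat.cast_le.2 hi
      exact degLE_mono (by nlinarith) (hr i)
  · rintro ⟨i, hi, hne⟩
    refine (natTrailingDegree_le_of_ne_zero ?_).trans_lt hi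
    simpa [coeff_initialForm] using hne

/-- Translating `p` by an approximate root of its `k`-th Hasse derivative, where `k + 1` is the
trailing degree of the initial form, makes the `k`-th coefficient negligible. -/
theorem WeightLE.exists_taylor_coeff_mem_degLE {e : ℚ} {r : ℚ≥0} {p : FracPoly[X]} {k : ℕ}
    (hp : WeightLE (e + (k + 1 : ℕ) * r) r p)
    (hk : (initialForm (e + (k + 1 : ℕ) * r) r p).natTrailingDegree = k + 1) :
    ∃ b ∈ degLE r, coeffAt r b = 0 ∧ (Polynomial.taylor b p).coeff k ∈ degLE e := by
  set φ := initialForm (e + (k + 1 : ℕ) * r) r p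
  have hform := initialForm_hasseDeriv (e + (k + 1 : ℕ) * r) r p k
  have hlead : φ.trailingCoeff ≠ 0 := by
    refine trailingCoeff_nonzero_iff_nonzero.2 fun h0 => ?_
    rw [h0, natTrailingDegree_zero] at hk
    exact k.succ_ne_zero hk.symm
  rw [trailingCoeff, hk] at hlead
  have h0 : (Polynomial.hasseDeriv k φ).coeff 0 = 0 := by
    rw [hasseDeriv_coeff, coeff_eq_zero_of_lt_natTrailingDegree (by omega), mul_zero]
  have h1 : (Polynomial.hasseDeriv k φ).coeff 1 ≠ 0 := by
    rw [hasseDeriv_coeff, add_comm 1]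
    exact mul_ne_zero (by simp [Nat.cast_add_one_ne_zero]) hlead
  rw [← hform] at h0 h1
  obtain ⟨b, hb, hb0, hbp⟩ := (hp.hasseDeriv k).exists_eval_mem_degLE h0 h1
  refine ⟨b, hb, hb0, ?_⟩
  rw [taylor_coeff]
  convert hbp using 2
  push_cast
  ring

theorem WeightLE.rootMultiplicity_initialForm_lt {e r t : ℚ} {p : FracPoly[X]} {k : ℕ}
    (hr : WeightLE (e + (k + 1 : ℕ) * r) r p) (ht : 0 < t) (htr : t < r)
    (hlead : coeffAt e (p.coeff (k + 1)) ≠ 0) (hk : p.coeff k ∈ degLE e)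
    (hedge : (initialForm (e + (k + 1 : ℕ) * t) t p).natTrailingDegree < k + 1) (a : ℝ) :
    (initialForm (e + (k + 1 : ℕ) * t) t p).rootMultiplicity a < k + 1 := by
  have hdeg := hr.natDegree_initialForm htr hlead
  have hnext : (initialForm (e + (k + 1 : ℕ) * t) t p).nextCoeff = 0 := by
    rw [nextCoeff_of_natDegree_pos (hdeg.trans_gt k.succ_pos), hdeg, Nat.add_sub_cancel,
      coeff_initialForm, coeffAt_eq_zero hk, ZeroMemClass.coe_zero]
    push_cast
    linarith
  simpa only [hdeg] using
    rootMultiplicity_lt_natDegree (initialForm_vertex_ne_zero hlead t) hnext (by rwa [hdeg]) a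

/-- Puiseux's argument, by induction on the trailing degree of the initial form: after the
translation of `exists_taylor_coeff_mem_degLE`, every root of the next edge polynomial has a smaller
multiplicity. -/
theorem WeightLE.locallyTame_zero {m : ℚ} {r : ℚ≥0} {p : FracPoly[X]} (hp : WeightLE m r p)
    (h0 : initialForm m r p ≠ 0) : LocallyTame p r 0 := by
  induction hd : (initialForm m r p).natTrailingDegree using Nat.strong_induction_on
    generalizing m r p with | _ d ih => ?_
  have hlead := trailingCoeff_nonzero_iff_nonzero.2 h0
  rw [trailingCoeff, hd] at hlead
  rcases d with _ | k
  · exact hp.locallyTame_of_eval_ne_zero (by rwa [← coeff_zero_eq_eval_zero])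
  rcases eq_zero_or_pos r with rfl | hr0
  · exact hp.locallyTame_zero_zero h0
  obtain ⟨e, rfl⟩ : ∃ e, m = e + (k + 1 : ℕ) * r := ⟨_, (sub_add_cancel m _).symm⟩
  obtain ⟨b, hb, hb0, hbk⟩ := hp.exists_taylor_coeff_mem_degLE hd
  have hq := hp.taylor hb
  have hform : initialForm (e + (k + 1 : ℕ) * r) r (Polynomial.taylor b p) = _ :=
    hp.initialForm_taylor hb
  refine .of_taylor hb ?_
  rw [hb0, ZeroMemClass.coe_zero, taylor_zero] at hform
  rw [hb0, ZeroMemClass.coe_zero, sub_zero]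
  rw [← hform] at hd hlead
  set q := Polynomial.taylor b p
  replace hlead : coeffAt e (q.coeff (k + 1)) ≠ 0 := by
    rw [coeff_initialForm_vertex] at hlead
    simpa using hlead
  obtain ⟨t, htr, ht, hedge⟩ := hq.exists_newton_edge hr0 hlead hd
  have ht0 := initialForm_vertex_ne_zero hlead t
  refine hq.locallyTame_zero_of_lt ht htr hlead hd
    (ht.locallyTame_of_forall_taylor ht0 fun a f hf hfa => ?_)
  have hf0 := hfa.trans_ne (mt (taylor_eq_zero _ _).1 ht0)
  rcases eq_zero_or_pos t with rfl | htpos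
  · exact hf.locallyTame_zero_zero hf0
  refine ih _ ?_ hf hf0 rfl
  rw [hfa, taylor_apply, ← rootMultiplicity_eq_natTrailingDegree]
  exact hq.rootMultiplicity_initialForm_lt (NNRat.cast_pos.2 htpos) (NNRat.cast_lt.2 htr) hlead hbk
    (hedge.resolve_left htpos.ne') a

theorem tameOn_sign_eval (p : FracPoly[X]) : TameOn (fun x => sign (p.eval x)) Set.univ := by
  by_cases hp0 : p = 0
  · exact (TameOn.const 0 _).congr fun x _ => by simp [hp0]
  set n := p.natDegree
  set e := deg p.leadingCoeff
  have hlead : coeffAt e (p.coeff n) ≠ 0 := coeffAt_deg_ne_zero (leadingCoeff_ne_zero.2 hp0)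
  have hu : (coeffAt e (p.coeff n) : ℝ) ≠ 0 := by simpa using hlead
  obtain ⟨t, ht, -⟩ := exists_newton_slope p n e
  have hweight : ∀ s : ℚ, t ≤ s → WeightLE (e + n * s) s p := by
    intro s hs i
    rcases lt_trichotomy i n with hi | rfl | hi
    · have hi' : (i : ℚ) < n := Nat.cast_lt.2 hi
      exact degLE_mono (by nlinarith) (ht i hi)
    · rw [add_sub_cancel_right]
      exact mem_degLE_deg _
    · rw [coeff_eq_zero_of_natDegree_lt hi]
      exact zero_mem _
  have ht0 := initialForm_vertex_ne_zero hlead t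
  refine (hweight t le_rfl).tameOn_of_locallyTame ht0
    ((hweight t le_rfl).locallyTame_of_forall_taylor ht0 fun a q hq hqa => ?_) fun x _ hx => ?_
  · exact hq.locallyTame_zero (hqa.trans_ne (mt (taylor_eq_zero _ _).1 ht0))
  · have hx0 : x ≠ 0 := fun h0 => hx (h0 ▸ zero_mem _)
    have hts : (t : ℚ) < deg x := NNRat.cast_lt.2 (not_le.1 (mt mem_degLE_coe.2 hx))
    have hlarge := hweight (deg x + 1) (by linarith)
    rw [leadingCoeff, hlarge.natDegree_initialForm (by linarith) hlead, coeff_initialForm_vertex]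
    exact (hweight (deg x) hts.le).sign_eval_of_monomial hu
      ((hweight t le_rfl).initialForm_eq_monomial hlarge hts (lt_add_one _))
      (mem_degLE_deg x) (coeffAt_deg_ne_zero hx0)

/-! ### Induction for tame predicates -/

theorem TameOn.induction {R : Type*} [LinearOrder R] [OrderBot R] [SuccOrder R] {P : R → Prop}
    (hP : TameOn P Set.univ) (hlim : ∀ x : R, ¬ Order.IsSuccLimit x) (bot : P ⊥)
    (succ : ∀ x, P x → P (Order.succ x)) (x : R) : P x := by
  -- Let `b` be least among `x` and the cut points at which `P` fails. It covers some `e` at which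
  -- `P` fails, whereas `P` holds at the last cut point `a` below `b`, hence at `succ a`, and no
  -- cut point distinguishes `succ a` from `e`.
  classical
  obtain ⟨C, hC⟩ := hP
  by_contra hx
  obtain ⟨b, hb, hbmin⟩ := ((insert x C).filter (¬ P ·)).exists_min_image id ⟨x, by simp [hx]⟩
  obtain ⟨-, hPb⟩ := Finset.mem_filter.1 hb
  have hb0 : ⊥ < b := bot_lt_iff_ne_bot.2 fun h => hPb (h ▸ bot)
  obtain ⟨e, heb⟩ : ∃ e, e ⋖ b :=
    Order.not_isSuccPrelimit_iff.1 fun h => hlim b ⟨not_isMin_of_lt hb0, h⟩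
  have hPe : ¬ P e := fun h => hPb (heb.succ_eq ▸ succ e h)
  obtain ⟨a, ha, hamax⟩ := ((insert ⊥ C).filter (· < b)).exists_max_image id ⟨⊥, by simp [hb0]⟩
  obtain ⟨haC, hab⟩ := Finset.mem_filter.1 ha
  have hPa : P a := by
    rcases Finset.mem_insert.1 haC with rfl | haC
    · exact bot
    · by_contra hPa
      exact hab.not_ge (hbmin a (by simp [haC, hPa]))
  have hae : a < e := (heb.le_of_lt hab).lt_of_ne fun h => hPe (h ▸ hPa)
  refine hPe ((hC _ trivial _ trivial fun c hc => ?_).mp (succ a hPa))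
  rcases lt_or_ge c b with hcb | hbc
  · have hca : c ≤ a := hamax c (by simp [hc, hcb])
    rw [(cmp_eq_gt_iff _ _).2 (hca.trans_lt hae),
      (cmp_eq_gt_iff _ _).2 (hca.trans_lt (Order.lt_succ_of_not_isMax (not_isMax_of_lt hae)))]
  · rw [(cmp_eq_lt_iff _ _).2 (heb.lt.trans_le hbc),
      (cmp_eq_lt_iff _ _).2 (((Order.succ_le_of_lt hae).trans_lt heb.lt).trans_le hbc)]

/-! ### Order and induction in Shepherdson's model -/

/-- The constant coefficient of a formal sum. -/
noncomputable def constCoeff : FracPoly →+* RealAlg where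
  toFun f := f.coeff 0
  map_zero' := by simp
  map_one' := by simp [AddMonoidAlgebra.one_def]
  map_add' f g := by simp
  map_mul' := coeff_zero_mul

theorem coeffAt_zero (f : FracPoly) : coeffAt 0 f = constCoeff f :=
  coeffAt_coe 0 f

theorem eq_of_mem_degLE_zero {f g : FracPoly} (hf : f ∈ degLE 0) (hg : g ∈ degLE 0)
    (h : constCoeff f = constCoeff g) : f = g := by
  have hdeg : deg (f - g) = 0 := by
    simpa using mem_degLE_coe.1 (show f - g ∈ degLE (0 : ℚ≥0) by simpa using sub_mem hf hg)
  by_contra hne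
  apply coeffAt_deg_ne_zero (sub_ne_zero.2 hne)
  rw [hdeg, NNRat.cast_zero, coeffAt_zero, map_sub, h, sub_self]

theorem one_le_of_pos {f : FracPoly} (hf : 0 < f) {k : ℤ} (hk : constCoeff f = k) : 1 ≤ f := by
  by_contra! hf1
  have hdeg : f ∈ degLE 0 := (ordConnected_degLE 0).out (zero_mem _) one_mem_degLE ⟨hf.le, hf1.le⟩
  have hk0 := coeffAt_le_coeffAt (zero_mem _) hdeg hf.le
  have hk1 := coeffAt_le_coeffAt hdeg one_mem_degLE hf1.le
  rw [map_zero, coeffAt_zero, hk] at hk0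
  rw [coeffAt_one, coeffAt_zero, hk] at hk1
  have hk01 : k = 0 ∨ k = 1 := by
    have : 0 ≤ k := by exact_mod_cast hk0
    have : k ≤ 1 := by exact_mod_cast hk1
    omega
  rcases hk01 with rfl | rfl
  · exact hf.ne' (eq_of_mem_degLE_zero hdeg (zero_mem _) (by simpa using hk))
  · exact hf1.ne (eq_of_mem_degLE_zero hdeg one_mem_degLE (by simpa using hk))

/-- The constant coefficient of an element of Shepherdson's model, as an integer. -/
noncomputable def constInt : Shepherdson →+* ℤ where
  toFun x := x.2.2.choose
  map_zero' := Int.cast_injective (α := RealAlg) <| by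
    rw [← (0 : Shepherdson).2.2.choose_spec]; simp
  map_one' := Int.cast_injective (α := RealAlg) <| by
    rw [← (1 : Shepherdson).2.2.choose_spec]; exact (map_one constCoeff).trans Int.cast_one.symm
  map_add' x y := Int.cast_injective (α := RealAlg) <| by
    rw [Int.cast_add, ← (x + y).2.2.choose_spec, ← x.2.2.choose_spec, ← y.2.2.choose_spec]; simp
  map_mul' x y := Int.cast_injective (α := RealAlg) <| by
    rw [Int.cast_mul, ← (x * y).2.2.choose_spec, ← x.2.2.choose_spec, ← y.2.2.choose_spec]
    exact coeff_zero_mul x y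

theorem constCoeff_coe (x : Shepherdson) : constCoeff (x : FracPoly) = constInt x :=
  x.2.2.choose_spec

theorem exists_coe_eq {f : FracPoly} (hf : 0 ≤ f) {k : ℤ} (hk : constCoeff f = k) :
    ∃ x : Shepherdson, (x : FracPoly) = f :=
  ⟨⟨f, sub_zero f ▸ hf, k, hk⟩, rfl⟩

theorem coe_nonneg (x : Shepherdson) : 0 ≤ (x : FracPoly) := by
  rw [le_iff_nonneg_sub, sub_zero]
  exact x.2.1

instance : CanonicallyOrderedAdd Shepherdson where
  exists_add_of_le {x y} h := by
    obtain ⟨z, hz⟩ := exists_coe_eq (f := y - x) (k := constInt y - constInt x)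
      (sub_nonneg.2 h) (by simp [constCoeff_coe])
    exact ⟨z, Subtype.ext (by simp [hz])⟩
  le_add_self x y := le_add_of_nonneg_left (coe_nonneg y)
  le_self_add x y := le_add_of_nonneg_right (coe_nonneg y)

theorem add_one_le_of_lt {x y : Shepherdson} (h : x < y) : x + 1 ≤ y := by
  obtain ⟨z, rfl⟩ := exists_add_of_le h.le
  have hz : 0 < z := pos_of_lt_add_right h
  exact add_le_add_right (α := Shepherdson) (one_le_of_pos (f := z) hz (constCoeff_coe z)) x

noncomputable instance : OrderBot Shepherdson where
  bot := 0
  bot_le _ := zero_le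

noncomputable instance : SuccAddOrder Shepherdson where
  __ := SuccOrder.ofSuccLeIff (fun x : Shepherdson => x + 1)
    ⟨(lt_add_one _).trans_le, add_one_le_of_lt⟩
  succ_eq_add_one _ := rfl

theorem exists_eq_add_one {x : Shepherdson} (hx : x ≠ 0) : ∃ y, x = y + 1 := by
  obtain ⟨y, rfl⟩ := exists_add_of_le (add_one_le_of_lt (pos_of_ne_zero hx))
  exact ⟨y, by ring⟩

theorem not_isSuccLimit (x : Shepherdson) : ¬ Order.IsSuccLimit x := by
  intro h
  obtain ⟨y, rfl⟩ := exists_eq_add_one (x := x) h.ne_bot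
  exact Order.not_isSuccPrelimit_succ y h.isSuccPrelimit

theorem single_strictMono (s : ℚ≥0) : StrictMono (single s : RealAlg → FracPoly) :=
  fun a b h => lt_of_coeffAt_lt (single_mem_degLE s a) (single_mem_degLE s b)
    (by simpa only [coeffAt_single] using h)

theorem exists_floor {c : FracPoly} (hc : 0 ≤ c) :
    ∃ d : Shepherdson, (d : FracPoly) ≤ c ∧ c < d + 1 := by
  set k := ⌊(constCoeff c : ℝ)⌋
  obtain ⟨a, ha⟩ : ∃ a : RealAlg, a = constCoeff c - k := ⟨_, rfl⟩
  have ha0 : 0 ≤ a := ha ▸ sub_nonneg.2 (Int.floor_le (constCoeff c : ℝ))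
  have ha1 : a < 1 := ha ▸ sub_lt_iff_lt_add'.2 (Int.lt_floor_add_one (constCoeff c : ℝ))
  set b : FracPoly := single 0 a
  have hb0 : 0 ≤ b := by simpa only [AddMonoidAlgebra.single_zero] using
    (single_strictMono 0).monotone ha0
  have hb1 : b < 1 := single_strictMono 0 ha1
  have hcb : constCoeff (c - b) = k := by
    have hb : constCoeff b = a := Finsupp.single_eq_same
    rw [map_sub, hb, ha, sub_sub_cancel]
  have hcb0 : 0 ≤ c - b := by
    by_contra! hneg
    have hle := one_le_of_pos (neg_pos.2 hneg) (k := -k) (by rw [map_neg, hcb, Int.cast_neg])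
    linarith
  obtain ⟨d, hd⟩ := exists_coe_eq hcb0 hcb
  exact ⟨d, by linarith, by linarith⟩

theorem tameOn_cmp_coe (c : FracPoly) :
    TameOn (fun x : Shepherdson => cmp (x : FracPoly) c) Set.univ := by
  rcases lt_or_ge c 0 with hc | hc
  · refine (TameOn.const .gt _).congr fun x _ => ?_
    exact ((cmp_eq_gt_iff _ _).2 (hc.trans_le (coe_nonneg x))).symm
  obtain ⟨d, hdc, hcd⟩ := exists_floor hc
  rcases hdc.eq_or_lt with rfl | hdc
  · exact TameOn.cmp_right d _
  refine ((TameOn.cmp_right d _).map fun o => if o = .gt then .gt else .lt).congr fun x _ => ?_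
  rcases lt_or_ge d x with hdx | hxd
  · have hcx : c < x := hcd.trans_le (add_one_le_of_lt hdx)
    simp [(cmp_eq_gt_iff _ _).2 hdx, (cmp_eq_gt_iff _ _).2 hcx]
  · have hxc : x < c := hdc.trans_le' hxd
    simp [cmp_eq_gt_iff, hxd.not_gt, (cmp_eq_lt_iff _ _).2 hxc]

theorem tameOn_sign_eval_coe (p : FracPoly[X]) :
    TameOn (fun x : Shepherdson => sign (p.eval (x : FracPoly))) Set.univ :=
  (tameOn_sign_eval p).comp (Set.mapsTo_univ _ _) tameOn_cmp_coe

/-! ### Terms and formulas in Shepherdson's model -/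

section Realize

variable {α : Type} (v : α → Shepherdson)

theorem realize_zero : (0 : arith.Term α).realize v = 0 := rfl

theorem realize_one : (1 : arith.Term α).realize v = 1 := rfl

theorem realize_add (s t : arith.Term α) : (s + t).realize v = s.realize v + t.realize v := rfl

theorem realize_mul (s t : arith.Term α) : (s * t).realize v = s.realize v * t.realize v := rfl

variable {n : ℕ} (w : Empty → Shepherdson) (xs : Fin n → Shepherdson)

theorem realize_two : (two : Tm n).realize (Sum.elim w xs) = 2 := one_add_one_eq_two

theorem realize_three : (three : Tm n).realize (Sum.elim w xs) = 3 := by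
  rw [three, realize_add, realize_two, realize_one, two_add_one_eq_three]

theorem realize_up (t : Tm n) (a : Shepherdson) :
    (up t).realize (Sum.elim w (Fin.snoc xs a)) = t.realize (Sum.elim w xs) := by
  rw [up, Term.realize_relabel]
  congr 1
  ext (i | i)
  · rfl
  · simp

theorem realize_new (a : Shepherdson) :
    (new : Tm (n + 1)).realize (Sum.elim w (Fin.snoc xs a)) = a := by
  simp [new]

theorem realize_le (s t : Tm n) :
    (le s t).Realize w xs ↔ s.realize (Sum.elim w xs) ≤ t.realize (Sum.elim w xs) := Iff.rfl

theorem realize_lt (s t : Tm n) :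
    (lt s t).Realize w xs ↔ s.realize (Sum.elim w xs) < t.realize (Sum.elim w xs) := by
  rw [lt, BoundedFormula.realize_inf, realize_le, BoundedFormula.realize_not,
    BoundedFormula.realize_bdEqual, lt_iff_le_and_ne]

theorem realize_dvd (s t : Tm n) :
    (dvd s t).Realize w xs ↔ s.realize (Sum.elim w xs) ∣ t.realize (Sum.elim w xs) := by
  simp only [dvd, BoundedFormula.realize_ex, BoundedFormula.realize_bdEqual, realize_mul,
    realize_up, realize_new]
  exact exists_congr fun a => by rw [mul_comm, eq_comm]

theorem realize_pow2 (t : Tm n) : (pow2 t).Realize w xs ↔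
    ∀ y : Shepherdson, y ∣ t.realize (Sum.elim w xs) → y = 1 ∨ 2 ∣ y := by
  simp only [pow2, BoundedFormula.realize_all, BoundedFormula.realize_imp,
    BoundedFormula.realize_sup, BoundedFormula.realize_bdEqual, realize_dvd, realize_up,
    realize_new, realize_one, realize_two]

theorem realize_pow2Tar (t : Tm n) : (pow2Tar t).Realize w xs ↔
    ∀ y z : Shepherdson, t.realize (Sum.elim w xs) ≠ (2 * y + 3) * z := by
  simp only [pow2Tar, BoundedFormula.realize_all, BoundedFormula.realize_not,
    BoundedFormula.realize_bdEqual, realize_mul, realize_add, realize_up, realize_new,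
    realize_two, realize_three, Ne]

end Realize

theorem isPow2_iff {a : Shepherdson} :
    IsPow2 a ↔ ∀ y : Shepherdson, y ∣ a → y = 1 ∨ 2 ∣ y :=
  realize_pow2 _ _ _

theorem isPow2Tar_iff {a : Shepherdson} :
    IsPow2Tar a ↔ ∀ y z : Shepherdson, a ≠ (2 * y + 3) * z :=
  realize_pow2Tar _ _ _

section Tame

variable {α : Type}

theorem exists_polynomial_realize_eq (w : α → Shepherdson[X]) (t : arith.Term α) :
    ∃ p : Shepherdson[X], ∀ x, t.realize (fun a => (w a).eval x) = p.eval x := by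
  induction t with
  | var a => exact ⟨w a, fun x => rfl⟩
  | func f ts ih =>
    choose p hp using ih
    change ArithFunc _ at f
    cases f with
    | zero => exact ⟨0, fun x => eval_zero.symm⟩
    | one => exact ⟨1, fun x => eval_one.symm⟩
    | add => exact ⟨p 0 + p 1, fun x => by rw [eval_add, ← hp, ← hp]; rfl⟩
    | mul => exact ⟨p 0 * p 1, fun x => by rw [eval_mul, ← hp, ← hp]; rfl⟩

theorem tameOn_eval_le_eval (p q : Shepherdson[X]) :
    TameOn (fun x => p.eval x ≤ q.eval x) Set.univ := by
  let ι := shepherdson.subtype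
  refine ((tameOn_sign_eval_coe (q.map ι - p.map ι)).map (0 ≤ ·)).congr fun x _ => ?_
  have hp : (p.map ι).eval (x : FracPoly) = p.eval x := eval_map_apply ι x
  have hq : (q.map ι).eval (x : FracPoly) = q.eval x := eval_map_apply ι x
  simp only [sign_nonneg_iff, eval_sub, sub_nonneg, hp, hq, Subtype.coe_le_coe]

theorem tameOn_eval_eq_eval (p q : Shepherdson[X]) :
    TameOn (fun x => p.eval x = q.eval x) Set.univ := by
  simpa only [← le_antisymm_iff] using (tameOn_eval_le_eval p q).map₂ (tameOn_eval_le_eval q p) And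

theorem tameOn_realize_of_isQF (w : α → Shepherdson[X]) {n : ℕ} (xs : Fin n → Shepherdson)
    {φ : arith.BoundedFormula α n} (hφ : φ.IsQF) :
    TameOn (fun x => φ.Realize (fun a => (w a).eval x) xs) Set.univ := by
  have hterm (t : arith.Term (α ⊕ Fin n)) : ∃ p : Shepherdson[X], ∀ x,
      t.realize (Sum.elim (fun a => (w a).eval x) xs) = p.eval x := by
    obtain ⟨p, hp⟩ := exists_polynomial_realize_eq (Sum.elim w (C ∘ xs)) t
    refine ⟨p, fun x => ?_⟩
    rw [← hp]
    congr 1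
    ext (a | i) <;> simp
  induction hφ with
  | falsum => exact .const False _
  | imp _ _ h₁ h₂ => exact h₁.map₂ h₂ (· → ·)
  | of_isAtomic h =>
    cases h with
    | equal t₁ t₂ =>
      obtain ⟨p, hp⟩ := hterm t₁
      obtain ⟨q, hq⟩ := hterm t₂
      simpa only [BoundedFormula.realize_bdEqual, hp, hq] using tameOn_eval_eq_eval p q
    | rel R ts =>
      change ArithRel _ at R
      cases R with
      | le =>
        obtain ⟨p, hp⟩ := hterm (ts 0)
        obtain ⟨q, hq⟩ := hterm (ts 1)
        exact (tameOn_eval_le_eval p q).congr fun x _ =>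
          (congrArg₂ (· ≤ ·) (hp x) (hq x)).symm

end Tame

theorem realize_induction {k : ℕ} {φ : arith.Formula (Fin k ⊕ Unit)} (hφ : φ.IsQF) :
    Shepherdson ⊨ induction φ := by
  rw [Sentence.Realize, induction, Formula.realize_iAlls]
  intro v
  rw [Formula.realize_relabel, Formula.realize_imp, Formula.realize_inf,
    Formula.realize_iAlls, Formula.realize_iAlls]
  rintro ⟨h0, hs⟩ b
  change Fin k → Shepherdson at v
  have hT := tameOn_realize_of_isQF (Sum.elim (C ∘ v) fun _ => X) default hφ
  have heval (x : Shepherdson) : (fun a => eval x (Sum.elim (C ∘ v) (fun _ : Unit => X) a)) =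
      Sum.elim v fun _ => x := by
    ext (i | _) <;> simp
  simp only [heval] at hT
  refine hT.induction not_isSuccLimit ?_ (fun x hx => ?_) (b ())
  · rw [Formula.Realize, BoundedFormula.realize_subst] at h0
    convert h0 using 2 with a
    rcases a with i | _ <;> rfl
  · have hsucc := Formula.realize_imp.1 (hs fun _ => x) hx
    rw [Formula.Realize, BoundedFormula.realize_subst] at hsucc
    convert hsucc using 2 with a
    rcases a with i | _ <;> rfl

theorem models_PAjer : Shepherdson ⊨ PAjer := by
  rw [Theory.model_iff]
  intro σ hσ
  simp only [PAjer, Set.mem_insert_iff, Set.mem_singleton_iff] at hσ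
  rcases hσ with rfl | rfl | rfl | rfl | rfl | rfl | rfl | rfl | rfl | rfl | rfl | rfl | rfl <;>
    simp only [Sentence.Realize, Formula.Realize, BoundedFormula.realize_all,
      BoundedFormula.realize_imp, BoundedFormula.realize_sup, BoundedFormula.realize_inf,
      BoundedFormula.realize_not, BoundedFormula.realize_bdEqual, realize_le, realize_add,
      realize_mul, realize_zero, realize_one]
  · exact add_zero
  · exact add_comm
  · exact add_assoc
  · exact mul_one
  · exact mul_comm
  · exact mul_assoc
  · exact mul_add
  · exact le_total
  · exact fun x y z h => h.1.trans h.2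
  · exact fun x => (lt_add_one x).not_ge
  · exact fun x y h => h.eq_or_lt.imp_right add_one_le_of_lt
  · exact fun x y z h => add_le_add_left h z
  · exact fun x y z h => mul_le_mul_left h z

theorem models_subtraction : Shepherdson ⊨ subtraction := by
  simp only [subtraction, Sentence.Realize, Formula.Realize, BoundedFormula.realize_all,
    BoundedFormula.realize_imp, BoundedFormula.realize_ex, BoundedFormula.realize_bdEqual,
    realize_le, realize_add]
  exact fun x y h => exists_add_of_le h

theorem models_IOpen : Shepherdson ⊨ IOpen := by
  rw [Theory.model_iff]
  rintro σ ((hσ | rfl) | ⟨k, φ, hφ, rfl⟩)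
  · exact Theory.model_iff _ |>.1 models_PAjer σ hσ
  · exact models_subtraction
  · exact realize_induction hφ

/-! ### Powers of two in Shepherdson's model -/

theorem natCast_dvd_iff {n : ℕ} (hn : n ≠ 0) {x : Shepherdson} :
    (n : Shepherdson) ∣ x ↔ (n : ℤ) ∣ constInt x := by
  refine ⟨fun h => by simpa using map_dvd constInt h, fun ⟨k, hk⟩ => ?_⟩
  obtain ⟨f, hf⟩ : ∃ f : FracPoly, n * f = x := by
    refine ⟨(n : RealAlg)⁻¹ • (x : FracPoly), ?_⟩
    rw [← nsmul_eq_mul, ← Nat.cast_smul_eq_nsmul RealAlg, smul_smul,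
      mul_inv_cancel₀ (Nat.cast_ne_zero.2 hn), one_smul]
  have hn0 : (0 : FracPoly) < n := by exact_mod_cast hn.pos
  have hf0 : 0 ≤ f := nonneg_of_mul_nonneg_right (hf ▸ coe_nonneg x) hn0
  have hfk : constCoeff f = k := by
    apply mul_left_cancel₀ (Nat.cast_ne_zero.2 hn : (n : RealAlg) ≠ 0)
    rw [← map_natCast constCoeff, ← map_mul, hf, constCoeff_coe, hk]
    simp
  obtain ⟨y, rfl⟩ := exists_coe_eq hf0 hfk
  exact ⟨y, Subtype.ext hf.symm⟩

theorem two_dvd_iff {x : Shepherdson} : 2 ∣ x ↔ 2 ∣ constInt x :=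
  mod_cast natCast_dvd_iff two_ne_zero

theorem not_two_dvd_two_mul_add_three (y : Shepherdson) : ¬ 2 ∣ 2 * y + 3 := by
  rw [two_dvd_iff, map_add, map_mul, map_ofNat, map_ofNat]
  omega

theorem exists_eq_two_mul_add_three {x : Shepherdson} (h2 : ¬ 2 ∣ x) (h1 : x ≠ 1) :
    ∃ y, x = 2 * y + 3 := by
  obtain ⟨a, rfl⟩ := exists_eq_add_one (x := x) (by rintro rfl; exact h2 (dvd_zero 2))
  obtain ⟨b, rfl⟩ : 2 ∣ a := by
    rw [two_dvd_iff, map_add, map_one] at h2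
    rw [two_dvd_iff]
    omega
  obtain ⟨c, rfl⟩ := exists_eq_add_one (x := b) (by rintro rfl; simp at h1)
  exact ⟨c, by ring⟩

theorem isPow2_iff_isPow2Tar (a : Shepherdson) : IsPow2 a ↔ IsPow2Tar a := by
  rw [isPow2_iff, isPow2Tar_iff]
  constructor
  · rintro h y z rfl
    rcases h (2 * y + 3) (dvd_mul_right _ _) with h1 | h2
    · have hlt : (1 : Shepherdson) < 2 * y + 3 := by
        calc (1 : Shepherdson) < 3 := by norm_num
          _ ≤ 2 * y + 3 := le_add_self
      exact hlt.ne' h1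
    · exact not_two_dvd_two_mul_add_three y h2
  · rintro h y ⟨z, rfl⟩
    by_contra! hy
    obtain ⟨w, rfl⟩ := exists_eq_two_mul_add_three hy.2 hy.1
    exact h w z rfl

theorem not_isPow2Tar_of_nonstandard (a : Shepherdson) (ha : ∀ n : ℕ, a ≠ n) :
    ¬ IsPow2Tar a := by
  -- If the constant coefficient `k` of `a` is `0`, then `a` is divisible by `3`; otherwise `a` is
  -- `|k|` times an element with constant coefficient `±1`, which is odd.
  rw [isPow2Tar_iff]
  push Not
  by_cases hk : constInt a = 0
  · obtain ⟨b, hb⟩ : ((3 : ℕ) : Shepherdson) ∣ a := by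
      rw [natCast_dvd_iff three_ne_zero, hk]
      exact dvd_zero _
    exact ⟨0, b, by rw [hb, mul_zero, zero_add, Nat.cast_ofNat]⟩
  have hk' : (constInt a).natAbs ≠ 0 := Int.natAbs_ne_zero.2 hk
  obtain ⟨b, hb⟩ := (natCast_dvd_iff hk').2 (Int.natAbs_dvd.2 dvd_rfl)
  have hb2 : ¬ 2 ∣ b := by
    have hab : ((constInt a).natAbs : ℤ) * constInt b =
        (constInt a).natAbs * (constInt a).sign := by
      rw [← map_natCast constInt, ← map_mul, ← hb, map_natCast, mul_comm, Int.sign_mul_natAbs]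
    have hsign : constInt b = (constInt a).sign := mul_left_cancel₀ (by exact_mod_cast hk') hab
    rw [two_dvd_iff, hsign]
    rcases Int.sign_trichotomy (constInt a) with h | h | h
    · omega
    · exact absurd (Int.sign_eq_zero_iff_zero.1 h) hk
    · omega
  have hb1 : b ≠ 1 := by
    rintro rfl
    exact ha _ (hb.trans (mul_one _))
  obtain ⟨y, rfl⟩ := exists_eq_two_mul_add_three hb2 hb1
  exact ⟨y, _, hb.trans (mul_comm _ _)⟩

theorem natCast_lt_single_one (n : ℕ) : (n : FracPoly) < single 1 1 := by
  have hn : (n : FracPoly) ∈ degLE 0 := by simpa using nsmul_mem one_mem_degLE n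
  have hX : single 1 1 ∈ degLE 1 := by simpa using single_mem_degLE 1 1
  refine lt_of_coeffAt_lt (degLE_mono zero_le_one hn) hX ?_
  rw [coeffAt_eq_zero hn one_pos]
  have hc : coeffAt 1 (single 1 1) = 1 := by simpa using coeffAt_single 1 1
  rw [hc]
  exact one_pos

theorem not_models_powersExistence : ¬ Shepherdson ⊨ powersExistence := by
  simp only [powersExistence, Sentence.Realize, Formula.Realize, BoundedFormula.realize_all,
    BoundedFormula.realize_ex, BoundedFormula.realize_inf, realize_lt, realize_le, realize_pow2,
    realize_add, realize_mul, realize_two, realize_one]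
  intro h
  obtain ⟨x, hx⟩ : ∃ x : Shepherdson, (x : FracPoly) = single 1 1 :=
    exists_coe_eq (k := 0) (by simpa using (natCast_lt_single_one 0).le)
      ((Finsupp.single_eq_of_ne zero_ne_one).trans Int.cast_zero.symm)
  have hlt (n : ℕ) : (n : Shepherdson) < x := by
    rw [← Subtype.coe_lt_coe, hx]
    exact_mod_cast natCast_lt_single_one n
  obtain ⟨y, hy, -, hxy⟩ := h x
  refine not_isPow2Tar_of_nonstandard y ?_ ((isPow2_iff_isPow2Tar y).1 (isPow2_iff.2 hy))
  rintro n rfl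
  have hxn : x + 1 < (2 * n : ℕ) := by
    push_cast
    exact hxy
  exact (hlt (2 * n)).not_gt ((lt_add_one x).trans hxn)

theorem not_IOpen_models_powersExistence : ¬ IOpen ⊨ᵇ powersExistence := by
  intro h
  have := models_IOpen
  exact not_models_powersExistence
    (Theory.models_sentence_iff.1 h (Theory.ModelType.of IOpen Shepherdson))

end Arith

theorem mainTheorem11 :
    (Arith.Shepherdson ⊨ Arith.IOpen) ∧
    (∀ α : Arith.Shepherdson, Arith.IsPow2 α ↔ Arith.IsPow2Tar α) ∧
    (∀ α : Arith.Shepherdson, (∀ n : ℕ, α ≠ (n : Arith.Shepherdson)) →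
      ¬ Arith.IsPow2 α ∧ ¬ Arith.IsPow2Tar α) ∧
    ¬ (Arith.IOpen ⊨ᵇ Arith.powersExistence) ∧
    ¬ Arith.IsSubtheory Arith.PAsmu Arith.IOpen := by
  refine ⟨Arith.models_IOpen, Arith.isPow2_iff_isPow2Tar, fun α hα => ?_,
    Arith.not_IOpen_models_powersExistence, fun h => Arith.not_IOpen_models_powersExistence
      (h _ (Theory.models_sentence_of_mem (Or.inr (Or.inl rfl))))⟩
  have := Arith.not_isPow2Tar_of_nonstandard α hα
  exact ⟨fun h => this ((Arith.isPow2_iff_isPow2Tar α).1 h), this⟩
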